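/- **Theorem 3.2.** *Setting.* Let $\mathbb K$ be a field and let $(\widehat V,\sigma,m)$ be a braided algebra: $\widehat V$ is a $\mathbb K$-vector space, $m:\widehat V\otimes\widehat V\to\widehat V$ is linear and associative, $\sigma\in\operatorname{End}(\widehat V\otimes\widehat V)$ satisfies the braid equation, and $$\sigma(m\otimes\mathrm{id})=(\mathrm{id}\otimes m)(\sigma\otimes\mathrm{id})(\mathrm{id}\otimes\sigma),\qquad \sigma(\mathrm{id}\otimes m)=(m\otimes\mathrm{id})(\mathrm{id}\otimes\sigma)(\sigma\otimes\mathrm{id}).$$ Let $\mathbf 1\in\widehat V$ be a non-zero element with $m(\mathbf 1\otimes v)=m(v\otimes\mathbf 1)=v$, $\sigma(\mathbf 1\otimes v)=v\otimes\mathbf 1$ and $\sigma(v\otimes\mathbf 1)=\mathbf 1\otimes v$ for all $v\in\widehat V$, and let $V$ be a linear complement of $\mathbb K\mathbf 1$ in $\widehat V$ such that $\sigma$ and $m$ restrict to a braided algebra $(V,\sigma,m)$. *Product.* Let $\ast$ be the quantum quasi-shuffle product on $T(V)=\bigoplus_n V^{\otimes n}$: the bilinear product whose components $\ast_{p,q}:V^{\otimes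 p}\otimes V^{\otimes q}\to T(V)$ are the canonical identifications if $p=0$ or $q=0$, and for $p,q>0$ $$\ast_{p,q}=(\mathrm{id}\otimes\ast_{p-1,q})+(\mathrm{id}\otimes\ast_{p,q-1})(\beta_{p,1}\otimes\mathrm{id}^{\otimes(q-1)})+(m\otimes\ast_{p-1,q-1})(\mathrm{id}\otimes\beta_{p-1,1}\otimes\mathrm{id}^{\otimes(q-1)}),$$ where $\beta_{p,1}:V^{\otimes p}\otimes V\to V\otimes V^{\otimes p}$ is the composite $\sigma_1\sigma_2\cdots\sigma_p$ and $\sigma_i$ is $\sigma$ acting on the $i$-th and $(i+1)$-st tensor factors. Let $\mathbf D:T(\widehat V)\to T(V)$ be the linear map that deletes all $\mathbf 1$ in a pure tensor whose factors are each either $\mathbf 1$ or in $V$. *Monoid.* Let $\mathrm{GVB}_n^+$ be the monoid with generators $\sigma_i,\xi_i$ ($1\le i\le n-1$) and relations $\sigma_i\sigma_j=\sigma_j\sigma_i$, $\sigma_i\xi_j=\xi_j\sigma_i$, $\xi_i\xi_j=\xi_j\xi_i$ for $|i-j|>1$, and $\sigma_i\sigma_{i+1}\sigma_i=\sigma_{i+1}\sigma_i\sigma_{i+1}$,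 $\xi_i\xi_{i+1}\xi_i=\xi_{i+1}\xi_i\xi_{i+1}$, $\xi_i\sigma_{i+1}\sigma_i=\sigma_{i+1}\sigma_i\xi_{i+1}$, $\xi_{i+1}\sigma_i\sigma_{i+1}=\sigma_i\sigma_{i+1}\xi_i$ for $1\le i\le n-2$. It acts on $\widehat V^{\otimes n}$: $\sigma_i$ by $\sigma$, and $\xi_i$ by $v\otimes w\mapsto\mathbf 1\otimes m(v\otimes w)$, on the $i$-th and $(i+1)$-st factors. Let $l_v(\tau)$ be the number of letters $\xi_i$ in any expression of $\tau\in\mathrm{GVB}_n^+$. *Permutations.* In the symmetric group $\mathfrak S_n$ the product $\sigma\tau$ is the permutation $x\mapsto\tau(\sigma(x))$, and $s_i=(i,i+1)$. For $k+p+q\le n$ let $\mathfrak S_{p,q}^{\uparrow k}\subset\mathfrak S_n$ be the set of $\sigma$ that fix every point outside $\{k+1,\dots,k+p+q\}$ and satisfy $\sigma^{-1}(k+1)<\dots<\sigma^{-1}(k+p)$ and $\sigma^{-1}(k+p+1)<\dots<\sigma^{-1}(k+p+q)$; write $\mathfrak S_{p,q}=\mathfrak S_{p,q}^{\uparrow0}$.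 For a set $I$ let $\operatorname{des}_n(\le I)$ be the set of $\sigma\in\mathfrak S_n$ with $\{1\le r\le n-1:\sigma^{-1}(r)>\sigma^{-1}(r+1)\}\subseteq I$. Every $\sigma\in\mathfrak S_n$ is uniquely a product $\sigma^{(n-1)}\cdots\sigma^{(1)}$ in which $\sigma^{(k)}$ is either the identity (then put $t_k=0$) or $s_{t_k}s_{t_k+1}\cdots s_k$ with $1\le t_k\le k$; put $t_n=0$ and $$Q(\sigma)=\prod_{k:\ \sigma^{(k)}\ne e}\bigl(\sigma_{t_k}+(1-\delta_{t_k+1,t_{k+1}})\,\sigma_1\cdots\sigma_{t_k-1}\xi_{t_k}\bigr)\sigma_{t_k+1}\cdots\sigma_k\ \in\ \mathbb K[\mathrm{GVB}_n^+],$$ the product being taken with $k$ decreasing from left to right. For $p+q\le n$, $\sigma\in\mathfrak S_n$ and $\tau\in\mathrm{GVB}_n^+$ put $\mathbf M_{p,q}(\sigma,\tau)=Q(\sigma)\tau$ if $l=l_v(\tau)<p$ and $\sigma\in\mathfrak S_{p-l,q}^{\uparrow l}$, and $\mathbf M_{p,q}(\sigma,\tau)=0$ otherwise; extend this linearly in $\tau$.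 *Statement.* Let $1\le i<j<n$ and $I=\{i,j\}$. Multiplication is a bijection $\mathfrak S_{j,n-j}\times\mathfrak S_{i,j-i}\to\operatorname{des}_n(\le I)$; let $\sigma\mapsto(\sigma_L,\sigma_R)$ be its inverse, and put $Q_{\le I}(\sigma)=\mathbf M_{j,n-j}(\sigma_L,\mathbf M_{i,j-i}(\sigma_R,e))$. Then for all $v_1,\dots,v_n\in V$ $$\bigl((v_1\otimes\cdots\otimes v_i)\ast(v_{i+1}\otimes\cdots\otimes v_j)\bigr)\ast(v_{j+1}\otimes\cdots\otimes v_n)=\mathbf D\Bigl(\sum_{\sigma\in\operatorname{des}_n(\le I)}Q_{\le I}(\sigma)(v_1\otimes\cdots\otimes v_n)\Bigr),$$ where the tensor product on the right-hand side is regarded in $\widehat V^{\otimes n}$. -/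

import Mathlib

open scoped TensorProduct DirectSum

noncomputable section

namespace QuasiShuffle

/-! ### Permutations

`𝔖_n` is `Equiv.Perm (Fin n)`; the point `x : Fin n` stands for the position `x + 1`.
A permutation acts on tensors by permuting positions, `σ (v₁ ⊗ ⋯ ⊗ v_n) = v_{σ(1)} ⊗ ⋯ ⊗ v_{σ(n)}`.
This is a left action for the product `σ τ` that applies `σ` first, i.e. for `σ.trans τ`, which is
therefore the product of `𝔖_n` used throughout. -/

section Permutations

/-- The simple transposition `s_i = (i, i+1)` of `𝔖_n`, for `1 ≤ i ≤ n - 1`. -/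
def simpleRefl (n i : ℕ) : Equiv.Perm (Fin n) :=
  if h : 1 ≤ i ∧ i < n then Equiv.swap ⟨i - 1, by omega⟩ ⟨i, h.2⟩ else Equiv.refl _

/-- The product `σ₁ σ₂ ⋯ σ_r` of a list of permutations. -/
def permProd {n : ℕ} (l : List (Equiv.Perm (Fin n))) : Equiv.Perm (Fin n) :=
  l.foldr Equiv.trans (Equiv.refl _)

/-- The list of integers `a, a + 1, …, b` (empty if `b < a`). -/
def interval (a b : ℕ) : List ℕ := List.range' a (b + 1 - a)

/-- `s_t s_{t+1} ⋯ s_k` for `1 ≤ t ≤ k`, and the identity for `t = 0`: the elements of `𝔖_{k,1}`. -/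
def bubble (n t k : ℕ) : Equiv.Perm (Fin n) :=
  if t = 0 then Equiv.refl _ else permProd ((interval t k).map (simpleRefl n))

/-- `σ ∈ 𝔖_{p,q}^{↑k}`, seen in `𝔖_n` with `k + p + q ≤ n`: `σ` permutes the positions
`k + 1, …, k + p + q`, fixes the others, and is there a `(p, q)`-shuffle, i.e.
`σ⁻¹(k+1) < ⋯ < σ⁻¹(k+p)` and `σ⁻¹(k+p+1) < ⋯ < σ⁻¹(k+p+q)`. -/
def IsShuffle {n : ℕ} (k p q : ℕ) (σ : Equiv.Perm (Fin n)) : Prop :=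
  (∀ x : Fin n, (x : ℕ) < k ∨ k + p + q ≤ x → σ x = x) ∧
  (∀ x y : Fin n, k ≤ x → x < y → (y : ℕ) < k + p → σ.symm x < σ.symm y) ∧
  (∀ x y : Fin n, k + p ≤ x → x < y → (y : ℕ) < k + p + q → σ.symm x < σ.symm y)

/-- The descent set `{1 ≤ i ≤ n - 1 | σ⁻¹(i) > σ⁻¹(i + 1)}`. -/
def descents {n : ℕ} (σ : Equiv.Perm (Fin n)) : Set ℕ :=
  {i | ∃ x y : Fin n, (x : ℕ) + 1 = i ∧ (y : ℕ) = i ∧ σ.symm y < σ.symm x}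

open Classical in
/-- `des_n(≤ I)`: the permutations all of whose descents lie in `I`. -/
def desLE (n : ℕ) (I : Set ℕ) : Finset (Equiv.Perm (Fin n)) :=
  Finset.univ.filter fun σ => descents σ ⊆ I

lemma simpleRefl_left {n i : ℕ} (h1 : 1 ≤ i) (h2 : i < n) :
    simpleRefl n i ⟨i - 1, by omega⟩ = ⟨i, h2⟩ := by
  rw [simpleRefl, dif_pos ⟨h1, h2⟩, Equiv.swap_apply_left]

lemma simpleRefl_fix {n i : ℕ} (x : Fin n) (h : i < x) : simpleRefl n i x = x := by
  rw [simpleRefl]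
  split_ifs with h'
  · apply Equiv.swap_apply_of_ne_of_ne <;> (intro e; rw [e] at h; simp at h; try omega)
  · rfl

lemma permProd_simpleRefl (n len : ℕ) : ∀ t : ℕ, 1 ≤ t → ∀ h : t - 1 + len < n,
    permProd ((List.range' t len).map (simpleRefl n)) ⟨t - 1, by omega⟩ = ⟨t - 1 + len, h⟩ ∧
    ∀ x : Fin n, t - 1 + len < x →
      permProd ((List.range' t len).map (simpleRefl n)) x = x := by
  induction len with
  | zero => intro t _ _; simp [permProd]
  | succ len ih =>
    intro t ht h
    obtain ⟨h1, h2⟩ := ih (t + 1) (by omega) (by omega)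
    have key : ∀ x, permProd ((List.range' t (len + 1)).map (simpleRefl n)) x =
        permProd ((List.range' (t + 1) len).map (simpleRefl n)) (simpleRefl n t x) := by
      intro x; simp [permProd, List.range'_succ]
    refine ⟨?_, ?_⟩
    · rw [key, simpleRefl_left ht (by omega)]
      refine Eq.trans h1 ?_
      ext; simp; omega
    · intro x hx
      rw [key, simpleRefl_fix x (by omega)]
      exact h2 x (by omega)

lemma exists_bubble_aux {n : ℕ} (m : ℕ) (hm : m ≤ n) : ∀ σ : Equiv.Perm (Fin n),
    (∀ x : Fin n, m ≤ x → σ x = x) →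
    ∃ t : ℕ → ℕ, (∀ k, t k ≤ k) ∧ (∀ k, m ≤ k → t k = 0) ∧
      permProd ((List.range m).reverse.map fun k => bubble n (t k) k) = σ := by
  induction m with
  | zero =>
    intro σ hσ
    refine ⟨fun _ => 0, by simp, by simp, ?_⟩
    ext x; simp [permProd, hσ x (Nat.zero_le _)]
  | succ m ih =>
    intro σ hσ
    set x := σ.symm ⟨m, hm⟩ with hx
    have hσx : σ x = ⟨m, hm⟩ := by simp [hx]
    have hxm : (x : ℕ) ≤ m := by
      by_contra hlt
      have := hσ x (by omega)
      rw [hσx] at this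
      rw [← this] at hlt; simp at hlt
    -- the permutation left after removing the outermost factor
    obtain ⟨r, hr, hc⟩ : ∃ r, r ≤ m ∧ bubble n r m x = ⟨m, hm⟩ ∧
        ∀ y : Fin n, m < y → bubble n r m y = y := by
      rcases Nat.lt_or_ge x m with hlt | hge
      · refine ⟨x + 1, by omega, ?_⟩
        obtain ⟨h1, h2⟩ := permProd_simpleRefl n (m + 1 - (x + 1)) (x + 1) (by omega) (by omega)
        rw [bubble, if_neg (by omega), interval]
        refine ⟨?_, fun y hy => h2 y (by omega)⟩
        refine Eq.trans h1 ?_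
        ext; simp; omega
      · refine ⟨0, by omega, ?_⟩
        rw [bubble, if_pos rfl]
        refine ⟨?_, fun _ _ => rfl⟩
        ext; simp; omega
    obtain ⟨hc1, hc2⟩ := hc
    obtain ⟨t, ht1, ht2, ht3⟩ := ih (by omega) ((bubble n r m).symm.trans σ) (by
      intro y hy
      rcases Nat.lt_or_ge m y with hlt | hge
      · have : (bubble n r m).symm y = y := by rw [Equiv.symm_apply_eq, hc2 y hlt]
        rw [Equiv.trans_apply, this, hσ y (by omega)]
      · have hy' : y = ⟨m, hm⟩ := by ext; simp; omega
        have : (bubble n r m).symm y = x := by rw [Equiv.symm_apply_eq, hc1, hy']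
        rw [Equiv.trans_apply, this, hσx, hy'])
    refine ⟨fun k => if k = m then r else t k, ?_, ?_, ?_⟩
    · intro k; dsimp only; split_ifs with h
      · omega
      · exact ht1 k
    · intro k hk; dsimp only; rw [if_neg (by omega)]; exact ht2 k (by omega)
    · have e : ((List.range m).reverse.map fun k => bubble n (if k = m then r else t k) k) =
          (List.range m).reverse.map fun k => bubble n (t k) k := by
        apply List.map_congr_left
        intro k hk
        rw [if_neg]; simp at hk; omega
      rw [List.range_succ, List.reverse_append, List.map_append, e]
      simp only [List.reverse_cons, List.reverse_nil, List.nil_append, List.map_cons, List.map_nil,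
        List.cons_append, if_true]
      change (bubble n r m).trans (permProd _) = σ
      rw [ht3]
      ext y; simp

/-- Existence of the bubble decomposition `σ = σ^{(n-1)} ⋯ σ^{(1)}`, where `σ^{(k)} ∈ 𝔖_{k,1}` is
`s_{t_k} ⋯ s_k`, or the identity if `t_k = 0`. (The factor with `k = 0` is the identity.) -/
lemma exists_bubble {n : ℕ} (σ : Equiv.Perm (Fin n)) :
    ∃ t : ℕ → ℕ, (∀ k, t k ≤ k) ∧ (∀ k, n ≤ k → t k = 0) ∧
      permProd ((List.range n).reverse.map fun k => bubble n (t k) k) = σ :=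
  exists_bubble_aux n le_rfl σ fun x hx => absurd x.2 (by omega)

/-- The numbers `t_k(σ)` of the bubble decomposition of `σ`. -/
def bubbleIndex {n : ℕ} (σ : Equiv.Perm (Fin n)) : ℕ → ℕ := (exists_bubble σ).choose

lemma symm_lt_symm {n : ℕ} {σ : Equiv.Perm (Fin n)} {I : Set ℕ} (h : descents σ ⊆ I) {a b : ℕ}
    (hI : ∀ c, a < c → c < b → c ∉ I) :
    ∀ x y : Fin n, a ≤ x → x < y → (y : ℕ) < b → σ.symm x < σ.symm y := by
  intro x y hx hxy hy
  obtain ⟨d, hd⟩ := Nat.exists_eq_add_of_lt (Fin.lt_def.1 hxy)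
  induction d generalizing y with
  | zero =>
    by_contra hn
    have hne : σ.symm y ≠ σ.symm x := fun e => hxy.ne' (σ.symm.injective e)
    exact hI y (by omega) hy (h ⟨x, y, by omega, rfl, lt_of_le_of_ne (not_lt.1 hn) hne⟩)
  | succ d ih =>
    have hz : (x : ℕ) + d + 1 < n := by omega
    have h1 := ih ⟨x + d + 1, hz⟩ (by rw [Fin.lt_def]; change (x : ℕ) < x + d + 1; omega)
      (by change (x : ℕ) + d + 1 < b; omega) rfl
    refine h1.trans ?_
    by_contra hn
    have hne : σ.symm y ≠ σ.symm ⟨x + d + 1, hz⟩ := fun e => by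
      have := congrArg Fin.val (σ.symm.injective e); simp at this; omega
    exact hI y (by omega) hy (h ⟨⟨x + d + 1, hz⟩, y, by change (x : ℕ) + d + 1 + 1 = y; omega, rfl,
      lt_of_le_of_ne (not_lt.1 hn) hne⟩)

/-- Every permutation in `des_n(≤ {i, j})` is a product of elements of `𝔖_{j,n-j}`
and `𝔖_{i,j-i}`. -/
lemma exists_decomposition {n i j : ℕ} (hij : i < j) (hj : j < n)
    (σ : desLE n {i, j}) :
    ∃ P : Equiv.Perm (Fin n) × Equiv.Perm (Fin n),
      IsShuffle 0 j (n - j) P.1 ∧ IsShuffle 0 i (j - i) P.2 ∧ P.1.trans P.2 = σ.1 := by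
  classical
  obtain ⟨σ, hσ⟩ := σ
  have hσ : descents σ ⊆ {i, j} := by simpa [desLE] using hσ
  have b1 := symm_lt_symm hσ (a := 0) (b := i) (by rintro c _ _ (rfl | rfl) <;> omega)
  have b2 := symm_lt_symm hσ (a := i) (b := j) (by rintro c _ _ (rfl | rfl) <;> omega)
  have b3 := symm_lt_symm hσ (a := j) (b := n) (by rintro c _ _ (rfl | rfl) <;> omega)
  set P : Finset (Fin n) := (Finset.univ.filter fun x : Fin n => (x : ℕ) < j).image σ.symm with hP
  have hcard : P.card = j := by
    rw [hP, Finset.card_image_of_injective _ σ.symm.injective]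
    rw [Fin.card_filter_val_lt]
    omega
  let g : Fin n → Fin n := fun x => if h : (x : ℕ) < j then P.orderEmbOfFin hcard ⟨x, h⟩
    else σ.symm x
  have gl : ∀ x : Fin n, ∀ h : (x : ℕ) < j, g x = P.orderEmbOfFin hcard ⟨x, h⟩ := fun x h =>
    dif_pos h
  have gr : ∀ x : Fin n, j ≤ (x : ℕ) → g x = σ.symm x := fun x h => dif_neg (by omega)
  have gP : ∀ x : Fin n, (x : ℕ) < j ↔ g x ∈ P := by
    intro x
    constructor
    · intro h; rw [gl x h]; exact Finset.orderEmbOfFin_mem _ _ _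
    · intro h
      by_contra hx
      rw [gr x (by omega), hP, Finset.mem_image] at h
      obtain ⟨y, hy, e⟩ := h
      rw [σ.symm.injective e] at hy
      simp at hy; omega
  have ginj : Function.Injective g := by
    intro x y e
    by_cases hx : (x : ℕ) < j
    · have hy : (y : ℕ) < j := by rw [gP, ← e, ← gP]; exact hx
      rw [gl x hx, gl y hy] at e
      have := (P.orderEmbOfFin hcard).injective e
      ext; simpa using this
    · have hy : ¬ (y : ℕ) < j := by rw [gP, ← e, ← gP]; exact hx
      rw [gr x (by omega), gr y (by omega)] at e
      exact σ.symm.injective e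
  let G : Equiv.Perm (Fin n) := Equiv.ofBijective g (Finite.injective_iff_bijective.1 ginj)
  have hG : ∀ x, G x = g x := fun _ => rfl
  have gmono : ∀ x y : Fin n, (x : ℕ) < j → (y : ℕ) < j → (g x < g y ↔ x < y) := by
    intro x y hx hy
    rw [gl x hx, gl y hy, OrderEmbedding.lt_iff_lt, Fin.lt_def, Fin.lt_def]
  -- `G` is the inverse of the left factor
  have small : ∀ x : Fin n, (x : ℕ) < j → (G.symm (σ.symm x) : ℕ) < j := by
    intro x hx
    rw [gP, ← hG, Equiv.apply_symm_apply, hP]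
    exact Finset.mem_image_of_mem _ (by simpa using hx)
  have mono : ∀ x y : Fin n, (x : ℕ) < j → (y : ℕ) < j → σ.symm x < σ.symm y →
      G.symm (σ.symm x) < G.symm (σ.symm y) := by
    intro x y hx hy h
    rw [← gmono _ _ (small x hx) (small y hy), ← hG, ← hG, Equiv.apply_symm_apply,
      Equiv.apply_symm_apply]
    exact h
  refine ⟨(G.symm, G.trans σ), ⟨?_, ?_, ?_⟩, ⟨?_, ?_, ?_⟩, ?_⟩
  · intro x hx; exfalso; have := x.2; omega
  · intro x y _ hxy hy
    have hxy' := Fin.lt_def.1 hxy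
    change g x < g y
    rw [gmono x y (by omega) (by omega)]; exact hxy
  · intro x y hx hxy hy
    have hxy' := Fin.lt_def.1 hxy
    change g x < g y
    rw [gr x (by omega), gr y (by omega)]
    exact b3 x y (by omega) hxy (by omega)
  · intro x hx
    change σ (g x) = x
    rw [gr x (by omega), Equiv.apply_symm_apply]
  · intro x y hx hxy hy
    have hxy' := Fin.lt_def.1 hxy
    exact mono x y (by omega) (by omega) (b1 x y hx hxy (by omega))
  · intro x y hx hxy hy
    have hxy' := Fin.lt_def.1 hxy
    exact mono x y (by omega) (by omega) (b2 x y (by omega) hxy (by omega))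
  · ext x; simp

/-- The pair `(σ_L, σ_R)` attached to `σ` by the bijection
`des_n(≤ {i, j}) ≃ 𝔖_{j,n-j} × 𝔖_{i,j-i}` whose inverse is the multiplication. -/
def decomposition {n i j : ℕ} (hij : i < j) (hj : j < n) (σ : desLE n {i, j}) :
    Equiv.Perm (Fin n) × Equiv.Perm (Fin n) :=
  (exists_decomposition hij hj σ).choose

end Permutations

/-! ### The generalized virtual braid monoid -/

section Monoid

/-- The generators `σ_i`, `ξ_i`, `1 ≤ i ≤ n - 1`. -/
inductive Gen (n : ℕ) : Type
  | sigma (i : ℕ) (h : 1 ≤ i ∧ i < n) : Gen n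
  | xi (i : ℕ) (h : 1 ≤ i ∧ i < n) : Gen n

/-- The word `σ_i` of length one. -/
def wσ {n : ℕ} (i : ℕ) (h : 1 ≤ i ∧ i < n) : FreeMonoid (Gen n) := FreeMonoid.of (.sigma i h)

/-- The word `ξ_i` of length one. -/
def wξ {n : ℕ} (i : ℕ) (h : 1 ≤ i ∧ i < n) : FreeMonoid (Gen n) := FreeMonoid.of (.xi i h)

/-- The defining relations of `GVB_n`. -/
inductive Rel (n : ℕ) : FreeMonoid (Gen n) → FreeMonoid (Gen n) → Prop
  | comm_ss (i j : ℕ) (hi : 1 ≤ i ∧ i < n) (hj : 1 ≤ j ∧ j < n) (h : i + 1 < j ∨ j + 1 < i) :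
      Rel n (wσ i hi * wσ j hj) (wσ j hj * wσ i hi)
  | comm_sx (i j : ℕ) (hi : 1 ≤ i ∧ i < n) (hj : 1 ≤ j ∧ j < n) (h : i + 1 < j ∨ j + 1 < i) :
      Rel n (wσ i hi * wξ j hj) (wξ j hj * wσ i hi)
  | comm_xx (i j : ℕ) (hi : 1 ≤ i ∧ i < n) (hj : 1 ≤ j ∧ j < n) (h : i + 1 < j ∨ j + 1 < i) :
      Rel n (wξ i hi * wξ j hj) (wξ j hj * wξ i hi)
  | braid_s (i : ℕ) (hi : 1 ≤ i ∧ i < n) (hi' : 1 ≤ i + 1 ∧ i + 1 < n) :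
      Rel n (wσ i hi * wσ (i + 1) hi' * wσ i hi) (wσ (i + 1) hi' * wσ i hi * wσ (i + 1) hi')
  | braid_x (i : ℕ) (hi : 1 ≤ i ∧ i < n) (hi' : 1 ≤ i + 1 ∧ i + 1 < n) :
      Rel n (wξ i hi * wξ (i + 1) hi' * wξ i hi) (wξ (i + 1) hi' * wξ i hi * wξ (i + 1) hi')
  | mixed_left (i : ℕ) (hi : 1 ≤ i ∧ i < n) (hi' : 1 ≤ i + 1 ∧ i + 1 < n) :
      Rel n (wξ i hi * wσ (i + 1) hi' * wσ i hi) (wσ (i + 1) hi' * wσ i hi * wξ (i + 1) hi')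
  | mixed_right (i : ℕ) (hi : 1 ≤ i ∧ i < n) (hi' : 1 ≤ i + 1 ∧ i + 1 < n) :
      Rel n (wξ (i + 1) hi' * wσ i hi * wσ (i + 1) hi') (wσ i hi * wσ (i + 1) hi' * wξ i hi)

/-- The generalized virtual braid monoid `GVB_n^+`. -/
abbrev GVB (n : ℕ) : Type := PresentedMonoid (Rel n)

/-- The virtual length `l_v : GVB_n^+ → ℕ`, the number of letters `ξ_i` in any expression, as a
homomorphism of monoids. -/
def virtualLengthHom (n : ℕ) : GVB n →* Multiplicative ℕ :=
  PresentedMonoid.lift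
    (fun g : Gen n => match g with
      | .sigma _ _ => 1
      | .xi _ _ => Multiplicative.ofAdd 1)
    (by rintro a b (_ | _ | _ | _ | _ | _ | _) <;> simp [wσ, wξ, mul_comm])

/-- The virtual length `l_v(τ)`. -/
def virtualLength {n : ℕ} (τ : GVB n) : ℕ := Multiplicative.toAdd (virtualLengthHom n τ)

variable (K : Type*) [Field K]

/-- `σ_i ∈ 𝕂[GVB_n^+]` for `1 ≤ i ≤ n - 1` (the value for other `i` is irrelevant). -/
def gσ (n i : ℕ) : MonoidAlgebra K (GVB n) :=
  if h : 1 ≤ i ∧ i < n then MonoidAlgebra.of K _ (PresentedMonoid.of (Rel n) (.sigma i h)) else 1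

/-- `ξ_i ∈ 𝕂[GVB_n^+]` for `1 ≤ i ≤ n - 1` (the value for other `i` is irrelevant). -/
def gξ (n i : ℕ) : MonoidAlgebra K (GVB n) :=
  if h : 1 ≤ i ∧ i < n then MonoidAlgebra.of K _ (PresentedMonoid.of (Rel n) (.xi i h)) else 1

/-- `σ_a σ_{a+1} ⋯ σ_b` (equal to `1` if `b < a`). -/
def gσProd (n a b : ℕ) : MonoidAlgebra K (GVB n) := ((interval a b).map (gσ K n)).prod

/-- The element
`∏_{k : σ^{(k)} ≠ e} (σ_{t_k} + (1 - δ_{t_k+1,t_{k+1}}) σ_1 ⋯ σ_{t_k-1} ξ_{t_k}) σ_{t_k+1} ⋯ σ_k`,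
where `k` decreases along the product. For a `(p, q)`-shuffle `σ` it is `Q_{p,q}(σ)`, and for
`σ ∈ 𝔖_{p,q}^{↑l}` it is `Q_{p,q}^{→ l}(σ)`. -/
def lift {n : ℕ} (σ : Equiv.Perm (Fin n)) : MonoidAlgebra K (GVB n) :=
  let t := bubbleIndex σ
  (((List.range n).reverse.filter fun k => t k ≠ 0).map fun k =>
    (gσ K n (t k) +
      (1 - if t k + 1 = t (k + 1) then 1 else 0) * (gσProd K n 1 (t k - 1) * gξ K n (t k))) *
    gσProd K n (t k + 1) k).prod

open Classical in
/-- `M_{p,q}(σ, τ)` for `σ ∈ 𝔖_n` and `τ ∈ GVB_n^+`, where `p + q ≤ n`. -/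
def MBasis {n : ℕ} (p q : ℕ) (σ : Equiv.Perm (Fin n)) (τ : GVB n) : MonoidAlgebra K (GVB n) :=
  if virtualLength τ < p ∧ IsShuffle (virtualLength τ) (p - virtualLength τ) q σ then
    lift K σ * MonoidAlgebra.of K _ τ
  else 0

/-- `M_{p,q}(σ, x)` for `σ ∈ 𝔖_n` and `x ∈ 𝕂[GVB_n^+]`, extended linearly in `x`. -/
def M {n : ℕ} (p q : ℕ) (σ : Equiv.Perm (Fin n)) (x : MonoidAlgebra K (GVB n)) :
    MonoidAlgebra K (GVB n) :=
  x.coeff.sum fun τ a => a • MBasis K p q σ τ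

/-- `Q_{≤ I}(σ) = M_{j,n-j}(σ_L, M_{i,j-i}(σ_R))` for `I = {i, j}`, where
`M_{i,j-i}(σ_R) = M_{i,j-i}(σ_R, e)`. -/
def QLE {n i j : ℕ} (hij : i < j) (hj : j < n) (σ : desLE n {i, j}) : MonoidAlgebra K (GVB n) :=
  M K j (n - j) (decomposition hij hj σ).1 (M K i (j - i) (decomposition hij hj σ).2 1)

end Monoid

/-! ### Operators on tensor powers -/

section Local

variable {K W : Type*} [Field K] [AddCommGroup W] [Module K W]
variable {ι : Type*} [DecidableEq ι]

/-- The linear map `a ⊗ b ↦ ⨂ w` where `w` is `v` with the entries at `i`, `j` replaced by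
`a`, `b`. -/
def insertTwo (v : ι → W) {i j : ι} (hij : i ≠ j) : W ⊗[K] W →ₗ[K] ⨂[K] _ : ι, W :=
  TensorProduct.lift (LinearMap.mk₂ K
    (fun a b => PiTensorProduct.tprod K (Function.update (Function.update v i a) j b))
    (fun a a' b => by simp only [Function.update_comm hij, MultilinearMap.map_update_add])
    (fun c a b => by simp only [Function.update_comm hij, MultilinearMap.map_update_smul])
    (fun a b b' => by simp only [MultilinearMap.map_update_add])
    (fun c a b => by simp only [MultilinearMap.map_update_smul]))

@[simp] lemma insertTwo_tmul (v : ι → W) {i j : ι} (hij : i ≠ j) (a b : W) :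
    insertTwo (K := K) v hij (a ⊗ₜ b) =
      PiTensorProduct.tprod K (Function.update (Function.update v i a) j b) := rfl

lemma insertTwo_update_left (v : ι → W) {i j : ι} (hij : i ≠ j) (x : W) :
    insertTwo (K := K) (Function.update v i x) hij = insertTwo v hij := by
  ext a b; simp

lemma insertTwo_update_right (v : ι → W) {i j : ι} (hij : i ≠ j) (x : W) :
    insertTwo (K := K) (Function.update v j x) hij = insertTwo v hij := by
  ext a b; simp [Function.update_comm hij]

lemma update_three {W : Type*} (v : ι → W) {i j k : ι} (hik : k ≠ i) (hjk : k ≠ j) (a b x : W) :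
    Function.update (Function.update (Function.update v k x) i a) j b =
      Function.update (Function.update (Function.update v i a) j b) k x := by
  rw [Function.update_comm hik, Function.update_comm hjk]

/-- The operator on `W^{⊗ ι}` that applies `f` to the tensor factors `i`, `j` (in this order) and
the identity to the others. -/
def twoSite {ι : Type*} [inst : DecidableEq ι] (f : W ⊗[K] W →ₗ[K] W ⊗[K] W) {i j : ι}
    (hij : i ≠ j) : Module.End K (⨂[K] _ : ι, W) :=
  PiTensorProduct.lift
    { toFun := fun v => insertTwo v hij (f (v i ⊗ₜ v j))
      map_update_add' := by
        intro dec v k x y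
        obtain rfl : dec = inst := Subsingleton.elim _ _
        rcases eq_or_ne k i with rfl | hi
        · simp [insertTwo_update_left, hij.symm, TensorProduct.add_tmul]
        rcases eq_or_ne k j with rfl | hj
        · simp [insertTwo_update_right, hij, TensorProduct.tmul_add]
        have e : insertTwo (K := K) (Function.update v k (x + y)) hij =
            insertTwo (Function.update v k x) hij + insertTwo (Function.update v k y) hij := by
          ext a b; simp [update_three v hi hj]
        simp [e, Function.update_of_ne hi.symm, Function.update_of_ne hj.symm]
      map_update_smul' := by
        intro dec v k c x
        obtain rfl : dec = inst := Subsingleton.elim _ _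
        rcases eq_or_ne k i with rfl | hi
        · simp [insertTwo_update_left, hij.symm, ← TensorProduct.smul_tmul']
        rcases eq_or_ne k j with rfl | hj
        · simp [insertTwo_update_right, hij]
        have e : insertTwo (K := K) (Function.update v k (c • x)) hij =
            c • insertTwo (Function.update v k x) hij := by
          ext a b; simp [update_three v hi hj]
        simp [e, Function.update_of_ne hi.symm, Function.update_of_ne hj.symm] }

lemma twoSite_tprod (f : W ⊗[K] W →ₗ[K] W ⊗[K] W) {i j : ι} (hij : i ≠ j) (v : ι → W) :
    twoSite f hij (PiTensorProduct.tprod K v) = insertTwo v hij (f (v i ⊗ₜ v j)) := by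
  simp [twoSite]

/-- `id^{⊗(i-1)} ⊗ f ⊗ id^{⊗(n-i-1)}` on `W^{⊗ n}`, for `1 ≤ i ≤ n - 1` (the value for other `i` is
irrelevant). -/
def localOp (n : ℕ) (f : W ⊗[K] W →ₗ[K] W ⊗[K] W) (i : ℕ) : Module.End K (⨂[K]^n W) :=
  if h : 1 ≤ i ∧ i < n then
    twoSite f (i := (⟨i - 1, by omega⟩ : Fin n)) (j := ⟨i, h.2⟩) (by simp [Fin.ext_iff]; omega)
  else 1

/-- `f ⊗ id` on `W ⊗ W ⊗ W`. -/
def op12 (f : W ⊗[K] W →ₗ[K] W ⊗[K] W) : Module.End K (W ⊗[K] (W ⊗[K] W)) :=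
  (TensorProduct.assoc K W W W).toLinearMap ∘ₗ f.rTensor W ∘ₗ
    (TensorProduct.assoc K W W W).symm.toLinearMap

/-- `id ⊗ f` on `W ⊗ W ⊗ W`. -/
def op23 (f : W ⊗[K] W →ₗ[K] W ⊗[K] W) : Module.End K (W ⊗[K] (W ⊗[K] W)) := f.lTensor W

lemma twoSite_comm (f g : W ⊗[K] W →ₗ[K] W ⊗[K] W) {i j k l : ι} (hij : i ≠ j) (hkl : k ≠ l)
    (hik : i ≠ k) (hil : i ≠ l) (hjk : j ≠ k) (hjl : j ≠ l) :
    twoSite f hij * twoSite g hkl = twoSite g hkl * twoSite f hij := by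
  refine PiTensorProduct.ext (MultilinearMap.ext fun v => ?_)
  simp only [LinearMap.compMultilinearMap_apply, Module.End.mul_apply, twoSite_tprod]
  obtain ⟨S, hS⟩ := TensorProduct.exists_finset (f (v i ⊗ₜ v j))
  obtain ⟨T, hT⟩ := TensorProduct.exists_finset (g (v k ⊗ₜ v l))
  have e1 : ∀ c d : W, twoSite f hij (insertTwo v hkl (c ⊗ₜ d)) =
      ∑ s ∈ S, PiTensorProduct.tprod K (Function.update (Function.update
        (Function.update (Function.update v k c) l d) i s.1) j s.2) := by
    intro c d
    rw [insertTwo_tmul, twoSite_tprod, Function.update_of_ne hil, Function.update_of_ne hik,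
      Function.update_of_ne hjl, Function.update_of_ne hjk, hS]
    simp
  have e2 : ∀ a b : W, twoSite g hkl (insertTwo v hij (a ⊗ₜ b)) =
      ∑ s ∈ T, PiTensorProduct.tprod K (Function.update (Function.update
        (Function.update (Function.update v i a) j b) k s.1) l s.2) := by
    intro a b
    rw [insertTwo_tmul, twoSite_tprod, Function.update_of_ne hjl.symm,
      Function.update_of_ne hil.symm, Function.update_of_ne hjk.symm,
      Function.update_of_ne hik.symm, hT]
    simp
  rw [hS, hT]
  simp only [map_sum, e1, e2]
  rw [Finset.sum_comm]
  refine Finset.sum_congr rfl fun s _ => Finset.sum_congr rfl fun t _ => ?_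
  rw [update_three _ hil.symm hjl.symm, update_three _ hik.symm hjk.symm]

/-- The linear map `a ⊗ b ⊗ c ↦ ⨂ w` where `w` is `v` with the entries at `i`, `j`, `k` replaced by
`a`, `b`, `c`. -/
def insertThree (v : ι → W) {i j k : ι} (hij : i ≠ j) (hik : i ≠ k) (hjk : j ≠ k) :
    W ⊗[K] (W ⊗[K] W) →ₗ[K] ⨂[K] _ : ι, W :=
  TensorProduct.lift (LinearMap.mk₂ K (fun a y => insertTwo (Function.update v i a) hjk y)
    (fun a a' y => by
      induction y using TensorProduct.induction_on with
      | zero => simp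
      | tmul p q => simp only [insertTwo_tmul, update_three _ hij hik,
          MultilinearMap.map_update_add]
      | add p q hp hq => simp only [map_add, hp, hq]; abel)
    (fun c a y => by
      induction y using TensorProduct.induction_on with
      | zero => simp
      | tmul p q => simp only [insertTwo_tmul, update_three _ hij hik,
          MultilinearMap.map_update_smul]
      | add p q hp hq => simp only [map_add, hp, hq, smul_add])
    (fun a y y' => map_add _ _ _) (fun c a y => map_smul _ _ _))

@[simp] lemma insertThree_tmul (v : ι → W) {i j k : ι} (hij : i ≠ j) (hik : i ≠ k) (hjk : j ≠ k)
    (a : W) (y : W ⊗[K] W) :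
    insertThree v hij hik hjk (a ⊗ₜ y) = insertTwo (Function.update v i a) hjk y := rfl

lemma twoSite_insertThree_left (f : W ⊗[K] W →ₗ[K] W ⊗[K] W) (v : ι → W) {i j k : ι}
    (hij : i ≠ j) (hik : i ≠ k) (hjk : j ≠ k) (x : W ⊗[K] (W ⊗[K] W)) :
    twoSite f hij (insertThree v hij hik hjk x) = insertThree v hij hik hjk (op12 f x) := by
  induction x using TensorProduct.induction_on with
  | zero => simp
  | add p q hp hq => simp only [map_add, hp, hq]
  | tmul a y =>
    induction y using TensorProduct.induction_on with
    | zero => simp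
    | add p q hp hq => simp only [TensorProduct.tmul_add, map_add, hp, hq]
    | tmul b c =>
      simp only [insertThree_tmul, insertTwo_tmul, twoSite_tprod, op12, LinearMap.comp_apply,
        LinearEquiv.coe_coe, TensorProduct.assoc_symm_tmul, LinearMap.rTensor_tmul]
      rw [Function.update_of_ne hik, Function.update_of_ne hij, Function.update_self,
        Function.update_of_ne hjk, Function.update_self]
      induction f (a ⊗ₜ b) using TensorProduct.induction_on with
      | zero => simp
      | add p q hp hq => simp only [TensorProduct.add_tmul, map_add, hp, hq]
      | tmul p q =>
        simp only [insertTwo_tmul, TensorProduct.assoc_tmul, insertThree_tmul]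
        congr 1
        ext z
        simp only [Function.update_apply]
        split_ifs <;> simp_all

lemma twoSite_insertThree_right (f : W ⊗[K] W →ₗ[K] W ⊗[K] W) (v : ι → W) {i j k : ι}
    (hij : i ≠ j) (hik : i ≠ k) (hjk : j ≠ k) (x : W ⊗[K] (W ⊗[K] W)) :
    twoSite f hjk (insertThree v hij hik hjk x) = insertThree v hij hik hjk (op23 f x) := by
  induction x using TensorProduct.induction_on with
  | zero => simp
  | add p q hp hq => simp only [map_add, hp, hq]
  | tmul a y =>
    induction y using TensorProduct.induction_on with
    | zero => simp
    | add p q hp hq => simp only [TensorProduct.tmul_add, map_add, hp, hq]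
    | tmul b c =>
      simp only [insertThree_tmul, insertTwo_tmul, twoSite_tprod, op23, LinearMap.lTensor_tmul]
      rw [Function.update_of_ne hjk, Function.update_self, Function.update_self,
        insertTwo_update_right, insertTwo_update_left]

lemma tprod_eq_insertThree (v : ι → W) {i j k : ι} (hij : i ≠ j) (hik : i ≠ k) (hjk : j ≠ k) :
    PiTensorProduct.tprod K v = insertThree v hij hik hjk (v i ⊗ₜ (v j ⊗ₜ v k)) := by
  simp

/-- A cubic relation between operators on `W ⊗ W ⊗ W` implies the corresponding relation between
local operators on three tensor factors. Here `true` stands for `f ⊗ id` and `false` for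
`id ⊗ f`. -/
lemma twoSite_relation (L R : List ((W ⊗[K] W →ₗ[K] W ⊗[K] W) × Bool)) {i j k : ι}
    (hij : i ≠ j) (hik : i ≠ k) (hjk : j ≠ k)
    (h : (L.map fun p => if p.2 then op12 p.1 else op23 p.1).prod =
      (R.map fun p => if p.2 then op12 p.1 else op23 p.1).prod) :
    (L.map fun p => if p.2 then twoSite p.1 hij else twoSite p.1 hjk).prod =
      (R.map fun p => if p.2 then twoSite p.1 hij else twoSite p.1 hjk).prod := by
  have key : ∀ (L : List ((W ⊗[K] W →ₗ[K] W ⊗[K] W) × Bool)) (v : ι → W) (x : W ⊗[K] (W ⊗[K] W)),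
      (L.map fun p => if p.2 then twoSite p.1 hij else twoSite p.1 hjk).prod
        (insertThree v hij hik hjk x) =
      insertThree v hij hik hjk
        ((L.map fun p => if p.2 then op12 p.1 else op23 p.1).prod x) := by
    intro L v x
    induction L with
    | nil => simp
    | cons p L ih =>
      rcases p with ⟨f, b⟩
      cases b
      · simp only [List.map_cons, List.prod_cons, Module.End.mul_apply, ih]
        exact twoSite_insertThree_right f v hij hik hjk _
      · simp only [List.map_cons, List.prod_cons, Module.End.mul_apply, ih]
        exact twoSite_insertThree_left f v hij hik hjk _
  refine PiTensorProduct.ext (MultilinearMap.ext fun v => ?_)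
  simp only [LinearMap.compMultilinearMap_apply]
  rw [tprod_eq_insertThree v hij hik hjk, key, key, h]

end Local

/-! ### Braided algebras -/

section Braided

/-- A braided algebra `(W, σ, m)`: an associative product `m` and a solution `σ` of the braid
equation such that `σ (m ⊗ id) = (id ⊗ m) (σ ⊗ id) (id ⊗ σ)` and
`σ (id ⊗ m) = (m ⊗ id) (id ⊗ σ) (σ ⊗ id)`. -/
structure BraidedAlgebra (K W : Type*) [Field K] [AddCommGroup W] [Module K W] where
  /-- The braiding. -/
  σ : W ⊗[K] W →ₗ[K] W ⊗[K] W
  /-- The multiplication. -/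
  m : W ⊗[K] W →ₗ[K] W
  braid : op12 σ ∘ₗ op23 σ ∘ₗ op12 σ = op23 σ ∘ₗ op12 σ ∘ₗ op23 σ
  assoc : m ∘ₗ m.rTensor W = m ∘ₗ m.lTensor W ∘ₗ (TensorProduct.assoc K W W W).toLinearMap
  braid_mul_left : σ ∘ₗ m.rTensor W ∘ₗ (TensorProduct.assoc K W W W).symm.toLinearMap =
    m.lTensor W ∘ₗ op12 σ ∘ₗ op23 σ
  braid_mul_right : σ ∘ₗ m.lTensor W =
    m.rTensor W ∘ₗ (TensorProduct.assoc K W W W).symm.toLinearMap ∘ₗ op23 σ ∘ₗ op12 σ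

/-- A braided algebra `(V̂, σ, m)` with a unit `𝟏 ≠ 0` compatible with the braiding and a linear
complement `V` of `𝕂 𝟏` such that `σ` and `m` restrict to a braided algebra structure on `V`. -/
structure AugmentedBraidedAlgebra (K W : Type*) [Field K] [AddCommGroup W] [Module K W] extends
    BraidedAlgebra K W where
  /-- The specified element `𝟏`. -/
  one : W
  one_ne_zero : one ≠ 0
  /-- The complement of `𝕂 𝟏`. -/
  V : Submodule K W
  isCompl : IsCompl (Submodule.span K {one}) V
  one_mul : ∀ v : W, m (one ⊗ₜ v) = v
  mul_one : ∀ v : W, m (v ⊗ₜ one) = v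
  braid_one_left : ∀ v : W, σ (one ⊗ₜ v) = v ⊗ₜ one
  braid_one_right : ∀ v : W, σ (v ⊗ₜ one) = one ⊗ₜ v
  /-- The braided algebra `(V, σ, m)`. -/
  restrict : BraidedAlgebra K V
  restrict_σ : ∀ x : V ⊗[K] V, TensorProduct.mapIncl V V (restrict.σ x) =
    σ (TensorProduct.mapIncl V V x)
  restrict_m : ∀ x : V ⊗[K] V, (restrict.m x : W) = m (TensorProduct.mapIncl V V x)

end Braided

/-! ### The quantum quasi-shuffle product -/

section QuasiShuffleProduct

variable {K V : Type*} [Field K] [AddCommGroup V] [Module K V]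

/-- For `φ : V → Hom(V^{⊗ n}, T)`, the map `v₀ ⊗ v₁ ⊗ ⋯ ⊗ v_n ↦ φ(v₀)(v₁ ⊗ ⋯ ⊗ v_n)`. -/
def uncurryTensor (n : ℕ) {T : Type*} [AddCommGroup T] [Module K T] :
    (V →ₗ[K] (⨂[K]^n V →ₗ[K] T)) →ₗ[K] (⨂[K]^(n + 1) V →ₗ[K] T) :=
  PiTensorProduct.lift.toLinearMap ∘ₗ
    (multilinearCurryLeftEquiv K (fun _ : Fin (n + 1) => V) T).symm.toLinearMap ∘ₗ
    LinearMap.compRight K (PiTensorProduct.lift (R := K) (s := fun _ : Fin n => V)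
      (E := T)).symm.toLinearMap

lemma uncurryTensor_tprod (n : ℕ) {T : Type*} [AddCommGroup T] [Module K T]
    (φ : V →ₗ[K] (⨂[K]^n V →ₗ[K] T)) (v : Fin (n + 1) → V) :
    uncurryTensor n φ (PiTensorProduct.tprod K v) =
      φ (v 0) (PiTensorProduct.tprod K (Fin.tail v)) := by
  simp [uncurryTensor]

/-- `id_V ⊗ g : V ⊗ V^{⊗ n} → T(V)`, for `g : V^{⊗ n} → T(V)`. -/
def consMap {n : ℕ} (g : ⨂[K]^n V →ₗ[K] TensorAlgebra K V) :
    ⨂[K]^(n + 1) V →ₗ[K] TensorAlgebra K V :=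
  uncurryTensor n ((LinearMap.mul K (TensorAlgebra K V)).compl₂ g ∘ₗ TensorAlgebra.ι K)

/-- `m ⊗ g : V ⊗ V ⊗ V^{⊗ n} → T(V)`, for `g : V^{⊗ n} → T(V)`. -/
def mulConsMap {n : ℕ} (m : V ⊗[K] V →ₗ[K] V) (g : ⨂[K]^n V →ₗ[K] TensorAlgebra K V) :
    ⨂[K]^(n + 2) V →ₗ[K] TensorAlgebra K V :=
  uncurryTensor (n + 1) (uncurryTensor n ∘ₗ (TensorProduct.mk K V V).compr₂
    ((LinearMap.mul K (TensorAlgebra K V)).compl₂ g ∘ₗ TensorAlgebra.ι K ∘ₗ m))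

lemma consMap_tprod {n : ℕ} (g : ⨂[K]^n V →ₗ[K] TensorAlgebra K V) (v : Fin (n + 1) → V) :
    consMap g (PiTensorProduct.tprod K v) =
      TensorAlgebra.ι K (v 0) * g (PiTensorProduct.tprod K (Fin.tail v)) := by
  simp [consMap, uncurryTensor_tprod]

lemma mulConsMap_tprod {n : ℕ} (m : V ⊗[K] V →ₗ[K] V) (g : ⨂[K]^n V →ₗ[K] TensorAlgebra K V)
    (v : Fin (n + 2) → V) :
    mulConsMap m g (PiTensorProduct.tprod K v) = TensorAlgebra.ι K (m (v 0 ⊗ₜ v 1)) *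
      g (PiTensorProduct.tprod K (Fin.tail (Fin.tail v))) := by
  simp [mulConsMap, uncurryTensor_tprod, Fin.tail]

/-- The operator `σ_a σ_{a+1} ⋯ σ_b` on `V^{⊗ n}`. -/
def braidProd (n : ℕ) (σ : V ⊗[K] V →ₗ[K] V ⊗[K] V) (a b : ℕ) : Module.End K (⨂[K]^n V) :=
  ((interval a b).map (localOp n σ)).prod

/-- The quantum quasi-shuffle product `V^{⊗ p} ⊗ V^{⊗ (n-p)} → T(V)` of a braided algebra, as a map
on `V^{⊗ n}`. It is the identification `V^{⊗ n} ⊆ T(V)` if `p = 0` or `p = n`, and for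
`p, q > 0` it is given by the recursion
`∗_{p,q} = (id ⊗ ∗_{p-1,q}) + (id ⊗ ∗_{p,q-1}) (β_{p,1} ⊗ id^{⊗(q-1)})
  + (m ⊗ ∗_{p-1,q-1}) (id ⊗ β_{p-1,1} ⊗ id^{⊗(q-1)})`,
where `β_{p,1} = σ_1 ⋯ σ_p : V^{⊗ p} ⊗ V → V ⊗ V^{⊗ p}` is the braiding. -/
def quasiShuffleAux (B : BraidedAlgebra K V) :
    (n p : ℕ) → (⨂[K]^n V →ₗ[K] TensorAlgebra K V)
  | 0, _ => TensorPower.toTensorAlgebra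
  | 1, _ => TensorPower.toTensorAlgebra
  | _ + 2, 0 => TensorPower.toTensorAlgebra
  | n + 2, p + 1 =>
    if p + 1 < n + 2 then
      consMap (quasiShuffleAux B (n + 1) p) +
      consMap (quasiShuffleAux B (n + 1) (p + 1)) ∘ₗ braidProd (n + 2) B.σ 1 (p + 1) +
      mulConsMap B.m (quasiShuffleAux B n p) ∘ₗ braidProd (n + 2) B.σ 2 (p + 1)
    else TensorPower.toTensorAlgebra

/-- The quantum quasi-shuffle product on `T(V)`. -/
def quasiShuffle (B : BraidedAlgebra K V) :
    TensorAlgebra K V →ₗ[K] TensorAlgebra K V →ₗ[K] TensorAlgebra K V :=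
  (DirectSum.toModule K ℕ ((⨁ q, ⨂[K]^q V) →ₗ[K] TensorAlgebra K V) fun p =>
    (DirectSum.toModule K ℕ (⨂[K]^p V →ₗ[K] TensorAlgebra K V) fun q =>
      ((TensorProduct.mk K (⨂[K]^p V) (⨂[K]^q V)).compr₂
        (quasiShuffleAux B (p + q) p ∘ₗ TensorPower.mulEquiv.toLinearMap)).flip).flip).compl₁₂
    TensorAlgebra.equivDirectSum.toLinearMap TensorAlgebra.equivDirectSum.toLinearMap

lemma quasiShuffle_tprod (B : BraidedAlgebra K V) {p q : ℕ} (v : Fin p → V) (w : Fin q → V) :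
    quasiShuffle B (TensorAlgebra.tprod K V p v) (TensorAlgebra.tprod K V q w) =
      quasiShuffleAux B (p + q) p (PiTensorProduct.tprod K (Fin.append v w)) := by
  have h := TensorPower.tprod_mul_tprod K v w
  rw [TensorPower.gMul_def] at h
  simp only [quasiShuffle, LinearMap.compl₁₂_apply, AlgEquiv.toLinearMap_apply,
    TensorAlgebra.equivDirectSum_apply, TensorAlgebra.toDirectSum_tensorPower_tprod]
  rw [← DirectSum.lof_eq_of K, ← DirectSum.lof_eq_of K, DirectSum.toModule_lof,
    LinearMap.flip_apply, DirectSum.toModule_lof]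
  simp [h]

/-- The tensor `v_{a+1} ⊗ ⋯ ⊗ v_b ∈ T(V)`. -/
def segment {n : ℕ} (v : Fin n → V) (a b : ℕ) (hb : b ≤ n) : TensorAlgebra K V :=
  TensorAlgebra.tprod K V (b - a) fun k => v ⟨a + k, by omega⟩

end QuasiShuffleProduct

namespace AugmentedBraidedAlgebra

variable {K W : Type*} [Field K] [AddCommGroup W] [Module K W] (A : AugmentedBraidedAlgebra K W)

/-- `σ^m (v ⊗ w) = 𝟏 ⊗ m(v ⊗ w)`. -/
def σm : W ⊗[K] W →ₗ[K] W ⊗[K] W := TensorProduct.mk K W W A.one ∘ₗ A.m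

@[simp] lemma σm_tmul (v w : W) : A.σm (v ⊗ₜ w) = A.one ⊗ₜ A.m (v ⊗ₜ w) := rfl

lemma op12_σm (y : W ⊗[K] (W ⊗[K] W)) : op12 A.σm y =
    A.one ⊗ₜ A.m.rTensor W ((TensorProduct.assoc K W W W).symm y) := by
  induction y using TensorProduct.induction_on with
  | zero => simp
  | add p q hp hq => simp only [map_add, hp, hq, TensorProduct.tmul_add]
  | tmul a y =>
    induction y using TensorProduct.induction_on with
    | zero => simp
    | add p q hp hq => simp only [map_add, hp, hq, TensorProduct.tmul_add]
    | tmul b c => simp [op12]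

lemma op23_σm (y : W ⊗[K] (W ⊗[K] W)) : op23 A.σm y =
    op12 A.σ (A.one ⊗ₜ A.m.lTensor W y) := by
  induction y using TensorProduct.induction_on with
  | zero => simp
  | add p q hp hq => simp only [map_add, hp, hq, TensorProduct.tmul_add]
  | tmul a y => simp [op12, op23, σm, A.braid_one_left]

lemma rel_x : op12 A.σm * op23 A.σm * op12 A.σm = op23 A.σm * op12 A.σm * op23 A.σm := by
  refine TensorProduct.ext_threefold' fun a b c => ?_
  have h := LinearMap.congr_fun A.assoc ((a ⊗ₜ b) ⊗ₜ c)
  simp at h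
  simp [op12, op23, h, A.one_mul, A.mul_one]

lemma rel_left : op12 A.σm * op23 A.σ * op12 A.σ = op23 A.σ * op12 A.σ * op23 A.σm := by
  refine LinearMap.ext fun y => ?_
  have h := LinearMap.congr_fun A.braid_mul_right y
  simp only [LinearMap.comp_apply, LinearEquiv.coe_coe] at h
  simp only [Module.End.mul_apply, op12_σm, ← h]
  clear h
  induction y using TensorProduct.induction_on with
  | zero => simp
  | add p q hp hq => simp only [map_add, ← hp, ← hq, TensorProduct.tmul_add]
  | tmul a y => simp [op12, op23, σm, A.braid_one_right]

lemma rel_right : op23 A.σm * op12 A.σ * op23 A.σ = op12 A.σ * op23 A.σ * op12 A.σm := by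
  refine LinearMap.ext fun y => ?_
  have h := LinearMap.congr_fun A.braid_mul_left y
  simp only [LinearMap.comp_apply, LinearEquiv.coe_coe] at h
  simp only [Module.End.mul_apply, op12_σm, op23_σm, ← h]
  simp [op23]

/-- The action of the generators of `GVB_n^+` on `V̂^{⊗ n}`:
`σ_i ↦ id^{⊗(i-1)} ⊗ σ ⊗ id^{⊗(n-i-1)}` and `ξ_i ↦ id^{⊗(i-1)} ⊗ σ^m ⊗ id^{⊗(n-i-1)}`. -/
def genAction (n : ℕ) : Gen n → Module.End K (⨂[K]^n W)
  | .sigma i _ => localOp n A.σ i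
  | .xi i _ => localOp n A.σm i

lemma localOp_comm (n : ℕ) (f g : W ⊗[K] W →ₗ[K] W ⊗[K] W) (i j : ℕ) (hi : 1 ≤ i ∧ i < n)
    (hj : 1 ≤ j ∧ j < n) (h : i + 1 < j ∨ j + 1 < i) :
    localOp n f i * localOp n g j = localOp n g j * localOp n f i := by
  rw [localOp, localOp, dif_pos hi, dif_pos hj]
  apply twoSite_comm <;> simp [Fin.ext_iff] <;> omega

lemma localOp_relation (n : ℕ) (f g h f' g' h' : W ⊗[K] W →ₗ[K] W ⊗[K] W) (i : ℕ)
    (hi : 1 ≤ i ∧ i < n) (hi' : 1 ≤ i + 1 ∧ i + 1 < n) :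
    (op12 f * op23 g * op12 h = op23 f' * op12 g' * op23 h' →
      localOp n f i * localOp n g (i + 1) * localOp n h i =
        localOp n f' (i + 1) * localOp n g' i * localOp n h' (i + 1)) ∧
    (op23 f * op12 g * op23 h = op12 f' * op23 g' * op12 h' →
      localOp n f (i + 1) * localOp n g i * localOp n h (i + 1) =
        localOp n f' i * localOp n g' (i + 1) * localOp n h' i) := by
  simp only [localOp, dif_pos hi, dif_pos hi']
  have hij : (⟨i - 1, by omega⟩ : Fin n) ≠ ⟨i, hi.2⟩ := by simp [Fin.ext_iff]; omega
  have hik : (⟨i - 1, by omega⟩ : Fin n) ≠ ⟨i + 1, hi'.2⟩ := by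
    intro e; have := congrArg Fin.val e; change i - 1 = i + 1 at this; omega
  have hjk : (⟨i, hi.2⟩ : Fin n) ≠ ⟨i + 1, hi'.2⟩ := by simp [Fin.ext_iff]
  constructor
  · intro e
    simpa [mul_assoc] using twoSite_relation [(f, true), (g, false), (h, true)]
      [(f', false), (g', true), (h', false)] hij hik hjk (by simpa [mul_assoc] using e)
  · intro e
    simpa [mul_assoc] using twoSite_relation [(f, false), (g, true), (h, false)]
      [(f', true), (g', false), (h', true)] hij hik hjk (by simpa [mul_assoc] using e)

/-- The representation of `GVB_n^+` on `V̂^{⊗ n}`. -/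
def monoidAction (n : ℕ) : GVB n →* Module.End K (⨂[K]^n W) :=
  PresentedMonoid.lift (A.genAction n) (by
    rintro a b (⟨i, j, hi, hj, h⟩ | ⟨i, j, hi, hj, h⟩ | ⟨i, j, hi, hj, h⟩ | ⟨i, hi, hi'⟩ |
      ⟨i, hi, hi'⟩ | ⟨i, hi, hi'⟩ | ⟨i, hi, hi'⟩) <;>
      simp only [wσ, wξ, map_mul, FreeMonoid.lift_eval_of, genAction]
    · exact localOp_comm n _ _ i j hi hj h
    · exact localOp_comm n _ _ i j hi hj h
    · exact localOp_comm n _ _ i j hi hj h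
    · exact (localOp_relation n _ _ _ _ _ _ i hi hi').1 A.braid
    · exact (localOp_relation n _ _ _ _ _ _ i hi hi').1 A.rel_x
    · exact (localOp_relation n _ _ _ _ _ _ i hi hi').1 A.rel_left
    · exact (localOp_relation n _ _ _ _ _ _ i hi hi').2 A.rel_right)

/-- The representation of `𝕂[GVB_n^+]` on `V̂^{⊗ n}`. -/
def action (n : ℕ) : MonoidAlgebra K (GVB n) →ₐ[K] Module.End K (⨂[K]^n W) :=
  MonoidAlgebra.lift K _ _ (A.monoidAction n)

/-- The linear form on `V̂ = 𝕂 𝟏 ⊕ V` with value `1` at `𝟏` and `0` on `V`. -/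
def counit : W →ₗ[K] K :=
  LinearEquiv.coord K W A.one A.one_ne_zero ∘ₗ
    Submodule.projectionOnto (Submodule.span K {A.one}) A.V A.isCompl

/-- The deleting operator `D : T(V̂) → T(V)`: the homomorphism for the concatenation product with
`𝟏 ↦ 1` and `v ↦ v` for `v ∈ V`, so that it deletes all `𝟏` in a tensor product of elements that
are either `𝟏` or in `V`. -/
def deleting : TensorAlgebra K W →ₐ[K] TensorAlgebra K A.V :=
  TensorAlgebra.lift K (Algebra.linearMap K (TensorAlgebra K A.V) ∘ₗ A.counit +
    TensorAlgebra.ι K ∘ₗ Submodule.projectionOnto A.V (Submodule.span K {A.one}) A.isCompl.symm)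

lemma deleting_one : A.deleting (TensorAlgebra.ι K A.one) = 1 := by
  have h : A.one ∈ Submodule.span K {A.one} := Submodule.mem_span_singleton_self _
  have h1 := Submodule.projectionOnto_apply_left A.isCompl ⟨A.one, h⟩
  have h2 := Submodule.projectionOnto_apply_right A.isCompl.symm ⟨A.one, h⟩
  simp only at h1 h2
  have h3 := LinearEquiv.coord_self K W A.one A.one_ne_zero
  simp [deleting, counit, h1, h2, h3]

lemma deleting_mem (v : A.V) :
    A.deleting (TensorAlgebra.ι K (v : W)) = TensorAlgebra.ι K v := by
  simp [deleting, counit]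

end AugmentedBraidedAlgebra

end QuasiShuffle

end

open scoped TensorProduct DirectSum

noncomputable section

namespace QuasiShuffle

/-! ### Shuffles and their bubble decompositions -/

section Combinatorics

variable {n : ℕ}

/-! The sum of the lifts `Q(σ)` over a set of shuffles obeys the same recursion as the quasi-shuffle
product. The first letter of a shuffled word comes from the first word or from the second. In the
second case the lift gains one factor on the right: a braiding `σ_t ⋯ σ_k` plus a contraction term
containing `ξ_t`. The Kronecker delta kills the contraction term precisely when the next letter
comes from the second word too, so the surviving contractions are summed over the shuffles of the
two words without their first letters. These three contributions are the three terms of `shuffleOp`;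
see `sum_lift_shuffles`.

On tensors, a contraction replaces `v ⊗ w` by `𝟏 ⊗ m(v ⊗ w)`, and the braiding then carries the unit
to the front, past everything already shuffled. Deletion leaves only `m(v ⊗ w)`, and the recursion
becomes that of `∗`. This is `deleting_shuffleOp`, in which the already shuffled part is an
arbitrary prefix `u` of degree `c`.

For three words, `des_n(≤ {i, j})` is a product of two sets of shuffles. Each monomial `τ` of the
inner sum takes the given tensor into `𝟏^{⊗ l} ⊗ V^{⊗ (n - l)}` with `l = l_v(τ) ≤ i < j`
(`shuffleOp_mul_of_mem`). For this `τ` the outer sum runs over `𝔖_{j-l,n-j}^{↑l}`, hence after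
deletion multiplies the first `j - l` letters from `V` with the last `n - j`. The linear map
`shuffleDeleting j (n - j)`, which cuts after `j` letters, deletes units in both pieces and
multiplies, gives the same result without mentioning `l`. The identity therefore extends to linear
combinations of monomials of different virtual length (`sum_M_eq_shuffleDeleting`), and on the inner
sum it yields the iterated product. -/

lemma simpleRefl_val {a : ℕ} (h : a + 1 < n) (x : Fin n) :
    (simpleRefl n (a + 1) x : ℕ) = if (x : ℕ) = a then a + 1 else if (x : ℕ) = a + 1 then a
      else x := by
  rw [simpleRefl, dif_pos ⟨by omega, h⟩, Equiv.swap_apply_def]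
  simp only [Fin.ext_iff, Nat.add_sub_cancel]
  split_ifs <;> simp_all

lemma permProd_cons (σ : Equiv.Perm (Fin n)) (l : List (Equiv.Perm (Fin n))) :
    permProd (σ :: l) = σ.trans (permProd l) := rfl

/-- The leftmost factor acts first, so `a` is handed on by every factor, while any other point is
moved by at most one of them. Points count from zero, the indices of the reflections from one. -/
lemma permProd_range'_val (len : ℕ) : ∀ a : ℕ, a + len < n → ∀ x : Fin n,
    (permProd ((List.range' (a + 1) len).map (simpleRefl n)) x : ℕ) =
      if (x : ℕ) = a then a + len else if a < x ∧ (x : ℕ) ≤ a + len then x - 1 else x := by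
  induction len with
  | zero => intro a _ x; simp [permProd]; split_ifs <;> omega
  | succ len ih =>
    intro a h x
    rw [List.range'_succ, List.map_cons, permProd_cons, Equiv.trans_apply, ih _ (by omega),
      simpleRefl_val (by omega)]
    split_ifs <;> omega

lemma bubble_val {a k : ℕ} (hak : a ≤ k) (hk : k < n) (x : Fin n) :
    (bubble n (a + 1) k x : ℕ) =
      if (x : ℕ) = a then k else if a < x ∧ (x : ℕ) ≤ k then x - 1 else x := by
  rw [bubble, if_neg (by omega), interval, permProd_range'_val _ _ (by omega)]
  split_ifs <;> omega

lemma bubble_symm_val {a k : ℕ} (hak : a ≤ k) (hk : k < n) (x : Fin n) :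
    ((bubble n (a + 1) k).symm x : ℕ) =
      if (x : ℕ) = k then a else if a ≤ x ∧ (x : ℕ) < k then x + 1 else x := by
  have h := bubble_val hak hk ((bubble n (a + 1) k).symm x)
  rw [Equiv.apply_symm_apply] at h
  split_ifs at h ⊢ <;> omega

lemma permProd_range_succ (f : ℕ → Equiv.Perm (Fin n)) (m : ℕ) :
    permProd ((List.range (m + 1)).reverse.map f) =
      (f m).trans (permProd ((List.range m).reverse.map f)) := by
  rw [List.range_succ, List.reverse_append]
  rfl

lemma bubble_fix {t k : ℕ} (htk : t ≤ k) (x : Fin n) (hx : k < x) : bubble n t k x = x := by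
  rcases t with _ | a
  · simp [bubble]
  · have := x.2
    ext
    rw [bubble_val (by omega) (by omega)]
    split_ifs <;> omega

lemma permProd_bubble_fix {t : ℕ → ℕ} (ht : ∀ k, t k ≤ k) (m : ℕ) (x : Fin n) (hx : m ≤ x) :
    permProd ((List.range m).reverse.map fun k => bubble n (t k) k) x = x := by
  induction m with
  | zero => simp [permProd]
  | succ m ih =>
    rw [permProd_range_succ, Equiv.trans_apply, bubble_fix (ht m) x (by omega), ih (by omega)]

lemma bubble_symm_self {t k : ℕ} (htk : t ≤ k) (hk : k < n) :
    ((bubble n t k).symm ⟨k, hk⟩ : ℕ) = if t = 0 then k else t - 1 := by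
  rcases t with _ | a
  · simp [bubble]
  · rw [bubble_symm_val (by omega) hk]; simp

/-- The factors of index below `m` fix the point `m`, so the preimage of `m` under the whole product
is already its preimage under the outermost bubble. That preimage determines the starting index;
cancel the bubble and induct. -/
lemma permProd_bubble_injective {t t' : ℕ → ℕ} (ht : ∀ k, t k ≤ k) (ht' : ∀ k, t' k ≤ k) (m : ℕ)
    (hm : m ≤ n) (h : permProd ((List.range m).reverse.map fun k => bubble n (t k) k) =
      permProd ((List.range m).reverse.map fun k => bubble n (t' k) k)) :
    ∀ k < m, t k = t' k := by
  induction m with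
  | zero => intro k hk; omega
  | succ m ih =>
    rw [permProd_range_succ, permProd_range_succ] at h
    have key : ∀ {s : ℕ → ℕ}, (∀ k, s k ≤ k) → ((bubble n (s m) m).trans
        (permProd ((List.range m).reverse.map fun k => bubble n (s k) k))).symm ⟨m, hm⟩ =
        (bubble n (s m) m).symm ⟨m, hm⟩ := by
      intro s hs
      rw [Equiv.symm_trans_apply,
        (Equiv.symm_apply_eq _).2 (permProd_bubble_fix hs m _ le_rfl).symm]
    have e : t m = t' m := by
      have h1 := key ht
      rw [h, key ht'] at h1
      have h2 := congrArg Fin.val h1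
      rw [bubble_symm_self (ht' m) hm, bubble_symm_self (ht m) hm] at h2
      have := ht m
      have := ht' m
      split_ifs at h2 <;> omega
    rw [e] at h
    have h' := ih (by omega) (by
      ext x
      have := Equiv.congr_fun h ((bubble n (t' m) m).symm x)
      simpa using congrArg Fin.val this)
    intro k hk
    rcases Nat.lt_succ_iff_lt_or_eq.1 hk with hk | rfl
    · exact h' k hk
    · exact e

/-- The bubble decomposition is unique. -/
lemma bubbleIndex_eq {σ : Equiv.Perm (Fin n)} {t : ℕ → ℕ} (ht : ∀ k, t k ≤ k)
    (ht0 : ∀ k, n ≤ k → t k = 0)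
    (h : permProd ((List.range n).reverse.map fun k => bubble n (t k) k) = σ) :
    bubbleIndex σ = t := by
  obtain ⟨h1, h2, h3⟩ := (exists_bubble σ).choose_spec
  funext k
  rcases Nat.lt_or_ge k n with hk | hk
  · exact permProd_bubble_injective h1 ht n le_rfl (h3.trans h.symm) k hk
  · rw [ht0 k hk]; exact h2 k hk

/-- The multiplication of `Equiv.Perm` is opposite to the product used here. Passing to the opposite
monoid makes general facts on list products available. -/
lemma permProd_eq_unop_prod (l : List (Equiv.Perm (Fin n))) :
    permProd l = (l.map MulOpposite.op).prod.unop := by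
  induction l with
  | nil => rfl
  | cons σ l ih => rw [permProd_cons, ih]; simp [Equiv.Perm.mul_def]

/-- Indices decrease from left to right and all factors below `a` are trivial, so a new factor at
`a` ends up at the far right. This serves both for bubbles in the opposite of the symmetric group
and for their lifts in the monoid algebra. -/
lemma prod_range_reverse_of_le {M : Type*} [Monoid M] {g g' : ℕ → M} {a m : ℕ} (ham : a < m)
    (h1 : ∀ k < a, g k = 1) (h2 : ∀ k ≤ a, g' k = 1) (h3 : ∀ k, a < k → g k = g' k) :
    ((List.range m).reverse.map g).prod = ((List.range m).reverse.map g').prod * g a := by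
  induction m, ham using Nat.le_induction with
  | base =>
    rw [List.range_succ]
    have e1 : ((List.range a).reverse.map g).prod = 1 :=
      List.prod_eq_one (by simpa using fun k hk => h1 k hk)
    have e2 : ((List.range a).reverse.map g').prod = 1 :=
      List.prod_eq_one (by simpa using fun k hk => h2 k (le_of_lt hk))
    rw [List.reverse_append, List.map_append, List.map_append, List.prod_append, List.prod_append,
      e1, e2]
    simp [h2 a le_rfl]
  | succ m hm ih =>
    rw [List.range_succ]
    simp only [List.reverse_append, List.reverse_singleton, List.singleton_append, List.map_cons,
      List.prod_cons, ih, h3 m hm, mul_assoc]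

/-- Changing the first nonzero bubble. -/
lemma permProd_bubble_update {t : ℕ → ℕ} {a : ℕ} (ha : a < n) (h0 : ∀ k ≤ a, t k = 0) (r : ℕ) :
    permProd ((List.range n).reverse.map fun k => bubble n (Function.update t a r k) k) =
      (permProd ((List.range n).reverse.map fun k => bubble n (t k) k)).trans (bubble n r a) := by
  have key := prod_range_reverse_of_le (m := n)
    (g := fun k => MulOpposite.op (bubble n (Function.update t a r k) k))
    (g' := fun k => MulOpposite.op (bubble n (t k) k)) ha
    (by
      intro k hk
      rw [Function.update_of_ne (by omega), h0 k (by omega)]; rfl)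
    (by intro k hk; rw [h0 k hk]; rfl)
    (by intro k hk; rw [Function.update_of_ne (by omega)])
  simp only [permProd_eq_unop_prod, List.map_map, Function.comp_def]
  rw [key]
  simp [Equiv.Perm.mul_def]

/-! ### Recursive structure of the set of shuffles -/

lemma IsShuffle.le_symm {k p q : ℕ} {σ : Equiv.Perm (Fin n)} (h : IsShuffle k p q σ) (x : Fin n)
    (hx : k ≤ x) : k ≤ (σ.symm x : ℕ) := by
  by_contra hlt
  have h1 := h.1 (σ.symm x) (Or.inl (by omega))
  rw [Equiv.apply_symm_apply] at h1
  rw [← h1] at hlt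
  omega

lemma eq_refl_of_symm_mono {k m : ℕ} {σ : Equiv.Perm (Fin n)}
    (h1 : ∀ x : Fin n, (x : ℕ) < k ∨ m ≤ x → σ x = x)
    (h2 : ∀ x y : Fin n, k ≤ x → x < y → (y : ℕ) < m → σ.symm x < σ.symm y) :
    σ = Equiv.refl _ := by
  have h1' : ∀ x : Fin n, (x : ℕ) < k ∨ m ≤ x → σ.symm x = x := fun x hx => by
    rw [Equiv.symm_apply_eq, h1 x hx]
  have h3 : ∀ x : Fin n, k ≤ x → (x : ℕ) < m → k ≤ (σ.symm x : ℕ) ∧ (σ.symm x : ℕ) < m := by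
    intro x hk hm
    by_contra hlt
    have h4 := h1 (σ.symm x) (by omega)
    rw [Equiv.apply_symm_apply] at h4
    rw [← h4] at hlt
    omega
  have hmono : StrictMono σ.symm := by
    intro x y hxy
    have hxy' := Fin.lt_def.1 hxy
    by_cases hx : k ≤ (x : ℕ) ∧ (x : ℕ) < m <;> by_cases hy : k ≤ (y : ℕ) ∧ (y : ℕ) < m
    · exact h2 x y hx.1 hxy hy.2
    · have := h3 x hx.1 hx.2
      rw [Fin.lt_def, h1' y (by omega)]; omega
    · have := h3 y hy.1 hy.2
      rw [Fin.lt_def, h1' x (by omega)]; omega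
    · rw [h1' x (by omega), h1' y (by omega)]; exact hxy
  -- A strictly monotone map on a well-order is determined by its range, and the range is
  -- everything.
  have h5 : ⇑σ.symm = id := (hmono.range_inj strictMono_id).1 (by
    rw [σ.symm.surjective.range_eq, Set.range_id])
  ext x
  have := congrFun h5 (σ x)
  simp only [Equiv.symm_apply_apply, id] at this
  simp [← this]

lemma isShuffle_refl (k p q : ℕ) : IsShuffle k p q (Equiv.refl (Fin n)) :=
  ⟨fun _ _ => rfl, fun _ _ _ h _ => h, fun _ _ _ h _ => h⟩

lemma isShuffle_zero_left {k q : ℕ} {σ : Equiv.Perm (Fin n)} :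
    IsShuffle k 0 q σ ↔ σ = Equiv.refl _ :=
  ⟨fun h => eq_refl_of_symm_mono h.1 h.2.2, by rintro rfl; exact isShuffle_refl _ _ _⟩

lemma isShuffle_zero_right {k p : ℕ} {σ : Equiv.Perm (Fin n)} :
    IsShuffle k p 0 σ ↔ σ = Equiv.refl _ :=
  ⟨fun h => eq_refl_of_symm_mono h.1 h.2.1, by rintro rfl; exact isShuffle_refl _ _ _⟩

/-- The fixed point `k` lies before everything that moves, so it may be counted as the first letter
of the first word. -/
lemma IsShuffle.of_succ {k p q : ℕ} {σ : Equiv.Perm (Fin n)} (h : IsShuffle (k + 1) p q σ) :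
    IsShuffle k (p + 1) q σ := by
  refine ⟨fun x hx => h.1 x (by omega), fun x y hx hxy hy => ?_,
    fun x y hx hxy hy => h.2.2 x y (by omega) hxy (by omega)⟩
  have hxy' := Fin.lt_def.1 hxy
  rcases Nat.eq_or_lt_of_le hx with hx | hx
  · have e : σ.symm x = x := by rw [Equiv.symm_apply_eq, h.1 x (by omega)]
    have := h.le_symm y (by omega)
    rw [e, Fin.lt_def]; omega
  · exact h.2.1 x y (by omega) hxy (by omega)

lemma IsShuffle.of_add {l k p q : ℕ} {σ : Equiv.Perm (Fin n)} (h : IsShuffle (k + l) p q σ) :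
    IsShuffle k (p + l) q σ := by
  induction l generalizing p with
  | zero => exact h
  | succ l ih =>
    have := ih (p := p + 1) (IsShuffle.of_succ h)
    rwa [show p + (l + 1) = p + 1 + l by omega]

lemma IsShuffle.succ {k p q : ℕ} {σ : Equiv.Perm (Fin n)} (h : IsShuffle k (p + 1) q σ)
    (hk : k < n) (hfix : σ ⟨k, hk⟩ = ⟨k, hk⟩) : IsShuffle (k + 1) p q σ := by
  refine ⟨fun x hx => ?_, fun x y hx hxy hy => h.2.1 x y (by omega) hxy (by omega),
    fun x y hx hxy hy => h.2.2 x y (by omega) hxy (by omega)⟩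
  by_cases hx' : (x : ℕ) = k
  · obtain rfl : x = ⟨k, hk⟩ := Fin.ext hx'
    exact hfix
  · exact h.1 x (by omega)

/-- The first letter of a shuffled word is the first letter of one of the two words. -/
lemma IsShuffle.apply_first {k p q : ℕ} {σ : Equiv.Perm (Fin n)} (h : IsShuffle k (p + 1) q σ)
    (hk : k < n) :
    σ ⟨k, hk⟩ = ⟨k, hk⟩ ∨ 0 < q ∧ (σ ⟨k, hk⟩ : ℕ) = k + p + 1 := by
  set y := σ ⟨k, hk⟩ with hy
  have hsymm : σ.symm y = ⟨k, hk⟩ := by simp [hy]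
  have hrange : k ≤ (y : ℕ) ∧ (y : ℕ) < k + (p + 1) + q := by
    by_contra hlt
    have e := h.1 y (by omega)
    have e' : y = ⟨k, hk⟩ := σ.injective (e.trans hy)
    rw [e'] at hlt
    simp at hlt; omega
  rcases Nat.lt_or_ge y (k + (p + 1)) with hlt | hge
  · left
    by_contra hne
    have hky : k < (y : ℕ) := lt_of_le_of_ne hrange.1 fun e => hne (Fin.ext e.symm)
    have h1 := h.2.1 ⟨k, hk⟩ y le_rfl hky hlt
    have h2 := h.le_symm ⟨k, hk⟩ le_rfl
    rw [hsymm, Fin.lt_def] at h1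
    simp at h1; omega
  · right
    refine ⟨by omega, ?_⟩
    by_contra hne
    have hb : k + (p + 1) < n := by omega
    have h1 := h.2.2 ⟨k + (p + 1), hb⟩ y le_rfl (by rw [Fin.lt_def]; dsimp only; omega) hrange.2
    have h2 := h.le_symm ⟨k + (p + 1), hb⟩ (by dsimp only; omega)
    rw [hsymm, Fin.lt_def] at h1
    dsimp only at h1; omega

/-- `σ` fixes `k`, and the bubble sends `k` to `k + p + 1`, the first letter of the second word,
while shifting the first word down by one. In the new shuffled word that letter therefore stands
first. -/
lemma IsShuffle.trans_bubble {k p q : ℕ} {σ : Equiv.Perm (Fin n)}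
    (h : IsShuffle (k + 1) (p + 1) q σ) (hn : k + (p + 1) + (q + 1) ≤ n) :
    IsShuffle k (p + 1) (q + 1) (σ.trans (bubble n (k + 1) (k + p + 1))) := by
  have hb := bubble_val (n := n) (a := k) (k := k + p + 1) (by omega) (by omega)
  have hbs := bubble_symm_val (n := n) (a := k) (k := k + p + 1) (by omega) (by omega)
  refine ⟨fun x hx => ?_, fun x y hx hxy hy => ?_, fun x y hx hxy hy => ?_⟩
  · rw [Equiv.trans_apply, h.1 x (by omega)]
    ext
    rw [hb]
    split_ifs <;> omega
  · have hxy' := Fin.lt_def.1 hxy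
    rw [Equiv.symm_trans_apply, Equiv.symm_trans_apply]
    refine h.2.1 _ _ ?_ ?_ ?_
    · rw [hbs]; split_ifs <;> omega
    · rw [Fin.lt_def, hbs, hbs]; split_ifs <;> omega
    · rw [hbs]; split_ifs <;> omega
  · have hxy' := Fin.lt_def.1 hxy
    rw [Equiv.symm_trans_apply, Equiv.symm_trans_apply]
    have ey : ((bubble n (k + 1) (k + p + 1)).symm y : ℕ) = y := by
      rw [hbs]; split_ifs <;> omega
    -- The new letter sits in position `k`, ahead of all other letters of the second word; those
    -- keep their places.
    by_cases hx' : (x : ℕ) = k + p + 1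
    · have ex : ((bubble n (k + 1) (k + p + 1)).symm x : ℕ) = k := by
        rw [hbs]; split_ifs; omega
      have e : σ.symm ((bubble n (k + 1) (k + p + 1)).symm x) =
          (bubble n (k + 1) (k + p + 1)).symm x := by
        rw [Equiv.symm_apply_eq, h.1 _ (by omega)]
      have := h.le_symm ((bubble n (k + 1) (k + p + 1)).symm y) (by omega)
      rw [e, Fin.lt_def]; omega
    · have ex : ((bubble n (k + 1) (k + p + 1)).symm x : ℕ) = x := by
        rw [hbs]; split_ifs <;> omega
      exact h.2.2 _ _ (by omega) (by rw [Fin.lt_def]; omega) (by omega)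

lemma IsShuffle.trans_bubble_symm {k p q : ℕ} {σ : Equiv.Perm (Fin n)}
    (h : IsShuffle k (p + 1) (q + 1) σ) (hn : k + (p + 1) + (q + 1) ≤ n)
    (hk : (σ ⟨k, by omega⟩ : ℕ) = k + p + 1) :
    IsShuffle (k + 1) (p + 1) q (σ.trans (bubble n (k + 1) (k + p + 1)).symm) := by
  have hb := bubble_val (n := n) (a := k) (k := k + p + 1) (by omega) (by omega)
  have hbs := bubble_symm_val (n := n) (a := k) (k := k + p + 1) (by omega) (by omega)
  refine ⟨fun x hx => ?_, fun x y hx hxy hy => ?_, fun x y hx hxy hy => ?_⟩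
  · rw [Equiv.trans_apply]
    ext
    by_cases hx' : (x : ℕ) = k
    · have ex : x = ⟨k, by omega⟩ := Fin.ext hx'
      rw [hbs, ex, hk]; simp
    · rw [h.1 x (by omega), hbs]
      split_ifs <;> omega
  · have hxy' := Fin.lt_def.1 hxy
    refine h.2.1 _ _ ?_ ?_ ?_
    · rw [Equiv.symm_symm, hb]; split_ifs <;> omega
    · rw [Fin.lt_def, Equiv.symm_symm, hb, hb]; split_ifs <;> omega
    · rw [Equiv.symm_symm, hb]; split_ifs <;> omega
  · have hxy' := Fin.lt_def.1 hxy
    refine h.2.2 _ _ ?_ ?_ ?_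
    · rw [Equiv.symm_symm, hb]; split_ifs <;> omega
    · rw [Fin.lt_def, Equiv.symm_symm, hb, hb]; split_ifs <;> omega
    · rw [Equiv.symm_symm, hb]; split_ifs <;> omega

lemma bubbleIndex_spec (σ : Equiv.Perm (Fin n)) :
    (∀ k, bubbleIndex σ k ≤ k) ∧ (∀ k, n ≤ k → bubbleIndex σ k = 0) ∧
      permProd ((List.range n).reverse.map fun k => bubble n (bubbleIndex σ k) k) = σ :=
  (exists_bubble σ).choose_spec

lemma bubbleIndex_refl : bubbleIndex (Equiv.refl (Fin n)) = 0 := by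
  refine bubbleIndex_eq (fun k => Nat.zero_le k) (fun _ _ => rfl) ?_
  induction List.range n using List.reverseRecOn with
  | nil => rfl
  | append_singleton l a ih =>
    rw [List.reverse_append, List.reverse_singleton, List.singleton_append, List.map_cons,
      permProd_cons, ih]
    rfl

lemma bubbleIndex_trans_bubble {σ : Equiv.Perm (Fin n)} {a r : ℕ} (ha : a < n) (hr : r ≤ a)
    (h0 : ∀ k ≤ a, bubbleIndex σ k = 0) :
    bubbleIndex (σ.trans (bubble n r a)) = Function.update (bubbleIndex σ) a r := by
  obtain ⟨h1, h2, h3⟩ := bubbleIndex_spec σ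
  refine bubbleIndex_eq (fun k => ?_) (fun k hk => ?_) ?_
  · rcases eq_or_ne k a with rfl | hne
    · simpa using hr
    · simpa [hne] using h1 k
  · rw [Function.update_of_ne (by omega), h2 k hk]
  · rw [permProd_bubble_update ha h0, h3]

/-- The bubbles of a shuffle only move letters of the second word, and never past the first
`k` positions. -/
lemma IsShuffle.bubbleIndex {k p q : ℕ} {σ : Equiv.Perm (Fin n)} (h : IsShuffle k p q σ)
    (hn : k + p + q ≤ n) : (∀ a < k + p, bubbleIndex σ a = 0) ∧
      ∀ a, bubbleIndex σ a = 0 ∨ k < bubbleIndex σ a := by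
  induction hN : p + q using Nat.strong_induction_on generalizing k p q σ with
  | _ N ih =>
    subst hN
    rcases p with _ | p
    · rw [isShuffle_zero_left] at h
      subst h
      simp [bubbleIndex_refl]
    rcases h.apply_first (by omega) with hfix | ⟨hq, hfirst⟩
    · obtain ⟨h1, h2⟩ := ih (p + q) (by omega) (h.succ _ hfix) (by omega) rfl
      exact ⟨fun a ha => h1 a (by omega), fun a => (h2 a).imp_right (by omega)⟩
    · obtain ⟨q, rfl⟩ := Nat.exists_eq_succ_of_ne_zero hq.ne'
      -- When the first letter comes from the second word, peel off its bubble. The remaining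
      -- shuffle has trivial bubbles up to index `k + p + 1`, so that bubble is the lowest
      -- nontrivial one.
      obtain ⟨h1, h2⟩ := ih (p + 1 + q) (by omega) (h.trans_bubble_symm hn hfirst) (by omega) rfl
      have e : σ = (σ.trans (bubble n (k + 1) (k + p + 1)).symm).trans
          (bubble n (k + 1) (k + p + 1)) := by ext; simp
      have e' := bubbleIndex_trans_bubble (n := n) (a := k + p + 1) (r := k + 1) (by omega)
        (by omega) fun a ha => h1 a (by omega)
      rw [← e] at e'
      rw [e']
      constructor
      · intro a ha
        rw [Function.update_of_ne (by omega), h1 a (by omega)]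
      · intro a
        rcases eq_or_ne a (k + p + 1) with rfl | hne
        · simp
        · rw [Function.update_of_ne hne]
          exact (h2 a).imp_right (by omega)

open Classical in
/-- The set `𝔖_{p,q}^{↑k}` of shuffles. -/
def shuffles (n k p q : ℕ) : Finset (Equiv.Perm (Fin n)) :=
  Finset.univ.filter fun σ => IsShuffle k p q σ

@[simp] lemma mem_shuffles {k p q : ℕ} {σ : Equiv.Perm (Fin n)} :
    σ ∈ shuffles n k p q ↔ IsShuffle k p q σ := by simp [shuffles]

/-- Summation over shuffles according to the first letter of the shuffled word. -/
lemma sum_shuffles_succ {E : Type*} [AddCommMonoid E] {k p q : ℕ}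
    (hn : k + (p + 1) + (q + 1) ≤ n) (f : Equiv.Perm (Fin n) → E) :
    ∑ σ ∈ shuffles n k (p + 1) (q + 1), f σ = ∑ σ ∈ shuffles n (k + 1) p (q + 1), f σ +
      ∑ σ ∈ shuffles n (k + 1) (p + 1) q, f (σ.trans (bubble n (k + 1) (k + p + 1))) := by
  classical
  have hk : k < n := by omega
  rw [← Finset.sum_filter_add_sum_filter_not _ (fun σ => σ ⟨k, hk⟩ = ⟨k, hk⟩)]
  congr 1
  · refine Finset.sum_congr ?_ fun _ _ => rfl
    ext σ
    simp only [Finset.mem_filter, mem_shuffles]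
    exact ⟨fun h => h.1.succ _ h.2, fun h => ⟨h.of_succ, h.1 _ (Or.inl (by simp))⟩⟩
  · symm
    refine Finset.sum_bij' (fun σ _ => σ.trans (bubble n (k + 1) (k + p + 1)))
      (fun σ _ => σ.trans (bubble n (k + 1) (k + p + 1)).symm) ?_ ?_ ?_ ?_ ?_
    · intro σ hσ
      rw [mem_shuffles] at hσ
      rw [Finset.mem_filter, mem_shuffles]
      refine ⟨hσ.trans_bubble hn, ?_⟩
      rw [Equiv.trans_apply, hσ.1 _ (Or.inl (by simp)), Fin.ext_iff,
        bubble_val (by omega) (by omega)]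
      simp; omega
    · intro σ hσ
      rw [Finset.mem_filter, mem_shuffles] at hσ
      rw [mem_shuffles]
      exact hσ.1.trans_bubble_symm hn ((hσ.1.apply_first hk).resolve_left hσ.2).2
    · intro σ _; ext; simp
    · intro σ _; ext; simp
    · intro σ _; rfl

/-- A shuffle fixes its first letter if and only if its first bubble does not start there. -/
lemma IsShuffle.succ_iff {k p q : ℕ} {σ : Equiv.Perm (Fin n)} (h : IsShuffle k (p + 1) q σ)
    (hn : k + (p + 1) + q ≤ n) :
    IsShuffle (k + 1) p q σ ↔ ¬ k + 1 = QuasiShuffle.bubbleIndex σ (k + p + 1) := by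
  constructor
  · intro h' e
    have := (h'.bubbleIndex (by omega)).2 (k + p + 1)
    omega
  · intro hne
    rcases h.apply_first (by omega) with hfix | ⟨hq, hfirst⟩
    · exact h.succ _ hfix
    · obtain ⟨q, rfl⟩ := Nat.exists_eq_succ_of_ne_zero hq.ne'
      -- Otherwise the first letter comes from the second word, and peeling off its bubble shows
      -- that the bubble of index `k + p + 1` starts at `k + 1`.
      have h1 := ((h.trans_bubble_symm hn hfirst).bubbleIndex (by omega)).1
      have e : σ = (σ.trans (bubble n (k + 1) (k + p + 1)).symm).trans
          (bubble n (k + 1) (k + p + 1)) := by ext; simp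
      have e' := bubbleIndex_trans_bubble (n := n) (a := k + p + 1) (r := k + 1) (by omega)
        (by omega) fun a ha => h1 a (by omega)
      rw [← e] at e'
      exact absurd (by rw [e']; simp) hne

end Combinatorics

/-! ### The sum of the lifts of all shuffles -/

section ShuffleOp

/-- The product `s_a s_{a+1} ⋯ s_b`. -/
def opProd {E : Type*} [Monoid E] (s : ℕ → E) (a b : ℕ) : E := ((interval a b).map s).prod

/-- For the generators `s`, `x` of a representation of the generalized virtual braid monoid, the
operator that quasi-shuffles the letters `c + 1, …, c + p` with the letters
`c + p + 1, …, c + p + q`, where each contraction of two letters puts a unit in front of the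
word. -/
def shuffleOp {E : Type*} [Semiring E] (s x : ℕ → E) : ℕ → ℕ → ℕ → E
  | _, 0, _ => 1
  | _, _ + 1, 0 => 1
  | c, p + 1, q + 1 => shuffleOp s x (c + 1) p (q + 1) +
      shuffleOp s x (c + 1) (p + 1) q * opProd s (c + 1) (c + p + 1) +
      shuffleOp s x (c + 2) p q * (opProd s 1 c * x (c + 1) * opProd s (c + 2) (c + p + 1))
termination_by _ p q => p + q

variable {E : Type*} [Semiring E] (s x : ℕ → E)

@[simp] lemma shuffleOp_zero_left (c q : ℕ) : shuffleOp s x c 0 q = 1 := by rw [shuffleOp]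

@[simp] lemma shuffleOp_zero_right (c p : ℕ) : shuffleOp s x c p 0 = 1 := by
  cases p <;> rw [shuffleOp]

lemma shuffleOp_succ (c p q : ℕ) : shuffleOp s x c (p + 1) (q + 1) =
    shuffleOp s x (c + 1) p (q + 1) +
      shuffleOp s x (c + 1) (p + 1) q * opProd s (c + 1) (c + p + 1) +
      shuffleOp s x (c + 2) p q *
        (opProd s 1 c * x (c + 1) * opProd s (c + 2) (c + p + 1)) := by
  rw [shuffleOp]

/-- Induction along the recursion that defines `shuffleOp`. -/
lemma shuffle_induction {P : ℕ → ℕ → ℕ → Prop} (left : ∀ c q, P c 0 q)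
    (right : ∀ c p, P c p 0)
    (step : ∀ c p q, P (c + 1) p (q + 1) → P (c + 1) (p + 1) q → P (c + 2) p q →
      P c (p + 1) (q + 1)) (c p q : ℕ) : P c p q := by
  induction hN : p + q using Nat.strong_induction_on generalizing c p q with
  | _ N ih =>
    subst hN
    rcases p with _ | p
    · exact left c q
    rcases q with _ | q
    · exact right c (p + 1)
    exact step c p q (ih _ (by omega) _ _ _ rfl) (ih _ (by omega) _ _ _ rfl)
      (ih _ (by omega) _ _ _ rfl)

lemma map_opProd {E F G : Type*} [Monoid E] [Monoid F] [FunLike G E F] [MonoidHomClass G E F]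
    (f : G) (s : ℕ → E) (a b : ℕ) : f (opProd s a b) = opProd (fun i => f (s i)) a b := by
  simp [opProd, map_list_prod, Function.comp_def]

lemma map_shuffleOp {F G : Type*} [Semiring F] [FunLike G E F] [RingHomClass G E F] (f : G)
    (c p q : ℕ) : f (shuffleOp s x c p q) =
      shuffleOp (fun i => f (s i)) (fun i => f (x i)) c p q := by
  induction c, p, q using shuffle_induction with
  | left c q => simp
  | right c p => simp
  | step c p q h1 h2 h3 => simp only [shuffleOp_succ, map_add, map_mul, map_opProd, h1, h2, h3]

lemma opProd_eq_mul {E : Type*} [Monoid E] (s : ℕ → E) {a b : ℕ} (h : a ≤ b) :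
    opProd s a b = s a * opProd s (a + 1) b := by
  rw [opProd, opProd, interval, interval, show b + 1 - a = b + 1 - (a + 1) + 1 by omega,
    List.range'_succ, List.map_cons, List.prod_cons]

lemma opProd_eq_one {E : Type*} [Monoid E] (s : ℕ → E) {a b : ℕ} (h : b < a) :
    opProd s a b = 1 := by
  rw [opProd, interval, show b + 1 - a = 0 by omega]; rfl

variable (K : Type*) [Field K] {n : ℕ}

/-- Trivial factors in place of the filter make the product run over all indices, as
`prod_range_reverse_of_le` requires. -/
lemma lift_eq_prod (σ : Equiv.Perm (Fin n)) : lift K σ = ((List.range n).reverse.map fun k =>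
    if bubbleIndex σ k = 0 then 1 else
    (gσ K n (bubbleIndex σ k) +
      (1 - if bubbleIndex σ k + 1 = bubbleIndex σ (k + 1) then 1 else 0) *
        (gσProd K n 1 (bubbleIndex σ k - 1) * gξ K n (bubbleIndex σ k))) *
    gσProd K n (bubbleIndex σ k + 1) k).prod := by
  rw [lift]
  induction (List.range n).reverse with
  | nil => rfl
  | cons a l ih =>
    by_cases h : bubbleIndex σ a = 0
    · simp only [List.filter_cons, h, List.map_cons, List.prod_cons, if_true, one_mul]
      simpa using ih
    · simp only [List.filter_cons, h, List.map_cons, List.prod_cons, if_false]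
      rw [← ih]
      simp [h]

lemma lift_refl : lift K (Equiv.refl (Fin n)) = 1 := by
  rw [lift_eq_prod, bubbleIndex_refl]
  exact List.prod_eq_one (by simp)

/-- The factor of index `a` involves only the bubble indices at `a` and `a + 1`. Adding a bubble
below all nontrivial ones thus leaves the existing factors unchanged, and the delta of the new
factor compares it with the lowest bubble that `σ` can have. -/
lemma lift_trans_bubble {k p q : ℕ} {σ : Equiv.Perm (Fin n)}
    (h : IsShuffle (k + 1) (p + 1) q σ) (hn : k + (p + 1) + (q + 1) ≤ n) :
    lift K (σ.trans (bubble n (k + 1) (k + p + 1))) = lift K σ *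
      ((gσ K n (k + 1) + (1 - if k + 1 + 1 = bubbleIndex σ (k + 1 + p + 1) then 1 else 0) *
        (gσProd K n 1 k * gξ K n (k + 1))) * gσProd K n (k + 2) (k + p + 1)) := by
  have h0 := (h.bubbleIndex (by omega)).1
  have e := bubbleIndex_trans_bubble (n := n) (a := k + p + 1) (r := k + 1) (by omega)
    (by omega) fun a ha => h0 a (by omega)
  rw [lift_eq_prod, lift_eq_prod, prod_range_reverse_of_le (a := k + p + 1) (by omega)]
  · rw [e, Function.update_self, Function.update_of_ne (by omega), if_neg (by omega),
      Nat.add_sub_cancel, show k + p + 1 + 1 = k + 1 + p + 1 by omega]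
  · intro a ha
    rw [e, Function.update_of_ne (by omega), h0 a (by omega), if_pos rfl]
  · intro a ha
    rw [h0 a (by omega), if_pos rfl]
  · intro a ha
    rw [e, Function.update_of_ne (by omega), Function.update_of_ne (by omega)]

/-- Sort the shuffles by their first letter. If it comes from the second word, `lift_trans_bubble`
supplies the extra factor, and by `IsShuffle.succ_iff` its delta vanishes exactly on the shuffles in
`𝔖_{p,q}^{↑(k+2)}`. The `ξ`-terms therefore add up to the third term of the recursion. -/
lemma sum_lift_shuffles (k p q : ℕ) (hn : k + p + q ≤ n) :
    ∑ σ ∈ shuffles n k p q, lift K σ = shuffleOp (gσ K n) (gξ K n) k p q := by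
  classical
  induction k, p, q using shuffle_induction with
  | left k q =>
    have : shuffles n k 0 q = {Equiv.refl _} := by ext; simp [isShuffle_zero_left]
    simp [this, lift_refl]
  | right k p =>
    have : shuffles n k p 0 = {Equiv.refl _} := by ext; simp [isShuffle_zero_right]
    simp [this, lift_refl]
  | step k p q h1 h2 h3 =>
    rw [sum_shuffles_succ hn, h1 (by omega), Finset.sum_congr rfl fun σ hσ =>
      lift_trans_bubble K (mem_shuffles.1 hσ) hn]
    have e : ∀ σ ∈ shuffles n (k + 1) (p + 1) q, lift K σ *
        ((gσ K n (k + 1) + (1 - if k + 1 + 1 = bubbleIndex σ (k + 1 + p + 1) then 1 else 0) *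
          (gσProd K n 1 k * gξ K n (k + 1))) * gσProd K n (k + 2) (k + p + 1)) =
        lift K σ * opProd (gσ K n) (k + 1) (k + p + 1) +
        (if IsShuffle (k + 2) p q σ then lift K σ else 0) *
          (opProd (gσ K n) 1 k * gξ K n (k + 1) * opProd (gσ K n) (k + 2) (k + p + 1)) := by
      intro σ hσ
      have hiff := (mem_shuffles.1 hσ).succ_iff (by omega)
      rw [opProd_eq_mul (a := k + 1) _ (by omega)]
      simp only [hiff, opProd, gσProd]
      split_ifs <;> simp_all [mul_add, add_mul, mul_assoc]
    rw [Finset.sum_congr rfl e, Finset.sum_add_distrib, ← Finset.sum_mul, ← Finset.sum_mul,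
      h2 (by omega), ← Finset.sum_filter, shuffleOp_succ, ← add_assoc]
    congr 2
    rw [← h3 (by omega)]
    refine Finset.sum_congr ?_ fun _ _ => rfl
    ext σ
    simp only [Finset.mem_filter, mem_shuffles]
    exact ⟨fun h => h.2, fun h => ⟨h.of_succ, h⟩⟩

end ShuffleOp

/-! ### Permutations with descents in `{i, j}` as products of two shuffles -/

section Decomposition

variable {n i j : ℕ}

/-- The inverse of the product applies `R⁻¹` first. This is increasing on the blocks of sizes `i`
and `j - i`, keeps their union and fixes the rest; `L⁻¹` is increasing on that union and on the
rest. -/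
lemma trans_mem_desLE (hij : i < j) (hj : j < n) {L R : Equiv.Perm (Fin n)}
    (hL : IsShuffle 0 j (n - j) L) (hR : IsShuffle 0 i (j - i) R) : L.trans R ∈ desLE n {i, j} := by
  classical
  rw [desLE, Finset.mem_filter]
  refine ⟨Finset.mem_univ _, ?_⟩
  rintro r ⟨x, y, hx, hy, hlt⟩
  by_contra hr
  simp only [Set.mem_insert_iff, Set.mem_singleton_iff, not_or] at hr
  refine absurd hlt (not_lt_of_gt ?_)
  have hfix : ∀ z : Fin n, j ≤ z → R.symm z = z := fun z hz => by
    rw [Equiv.symm_apply_eq, hR.1 z (by omega)]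
  have hsmall : ∀ z : Fin n, (z : ℕ) < j → (R.symm z : ℕ) < j := fun z hz => by
    by_contra hge
    have := hR.1 (R.symm z) (by omega)
    rw [Equiv.apply_symm_apply] at this
    rw [← this] at hge
    omega
  have hxy : x < y := by rw [Fin.lt_def]; omega
  rw [Equiv.symm_trans_apply, Equiv.symm_trans_apply]
  rcases Nat.lt_or_ge y j with hyj | hyj
  · refine hL.2.1 _ _ (by omega) ?_ (by have := hsmall y hyj; omega)
    rcases Nat.lt_or_ge y i with hyi | hyi
    · exact hR.2.1 x y (by omega) hxy (by omega)
    · exact hR.2.2 x y (by omega) hxy (by omega)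
  · rw [hfix x (by omega), hfix y (by omega)]
    exact hL.2.2 x y (by omega) hxy (by omega)

/-- `R` and `R'` fix all points from `j` on, so `L` and `L'` have the same preimages there. Hence
`L' L⁻¹` (as a composite of maps) preserves the points below `j`, and it is increasing on them
because `L⁻¹` and `L'⁻¹` are; so it is the identity. -/
lemma trans_shuffle_injective (hij : i < j) {L R L' R' : Equiv.Perm (Fin n)}
    (hL : IsShuffle 0 j (n - j) L) (hR : IsShuffle 0 i (j - i) R)
    (hL' : IsShuffle 0 j (n - j) L') (hR' : IsShuffle 0 i (j - i) R')
    (h : L.trans R = L'.trans R') : L = L' ∧ R = R' := by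
  have hfix : ∀ z : Fin n, j ≤ z → L (L'.symm z) = z := fun z hz => by
    have h1 := Equiv.congr_fun h (L'.symm z)
    rw [Equiv.trans_apply, Equiv.trans_apply, Equiv.apply_symm_apply, hR'.1 z (by omega)] at h1
    have h2 := hR.1 z (by omega)
    exact R.injective (h1.trans h2.symm)
  have hfix' : ∀ z : Fin n, j ≤ z → L' (L.symm z) = z := fun z hz => by
    have h1 := hfix z hz
    rw [← Equiv.eq_symm_apply] at h1
    rw [← h1, Equiv.apply_symm_apply]
  have hlt : ∀ x : Fin n, (x : ℕ) < j → (L' (L.symm x) : ℕ) < j := fun x hx => by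
    by_contra hge
    have h1 := hfix (L' (L.symm x)) (by omega)
    simp only [Equiv.symm_apply_apply, Equiv.apply_symm_apply] at h1
    rw [← h1] at hge
    omega
  have key : L'.symm.trans L = Equiv.refl _ := by
    refine eq_refl_of_symm_mono (k := 0) (m := j) (fun x hx => ?_) (fun x y _ hxy hy => ?_)
    · exact hfix x (by omega)
    · change L' (L.symm x) < L' (L.symm y)
      have hxy' := Fin.lt_def.1 hxy
      by_contra hge
      have hne : L' (L.symm y) ≠ L' (L.symm x) := fun e =>
        hxy.ne' (L.symm.injective (L'.injective e))
      have h1 := hL'.2.1 _ _ (Nat.zero_le _) (lt_of_le_of_ne (not_lt.1 hge) hne)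
        (by have := hlt x (by omega); omega)
      have h2 := hL.2.1 x y (Nat.zero_le _) hxy (by omega)
      simp only [Equiv.symm_apply_apply] at h1
      exact absurd h1 (not_lt_of_gt h2)
  have e : L = L' := by
    ext x
    have := Equiv.congr_fun key (L' x)
    simpa using congrArg Fin.val this
  subst e
  refine ⟨rfl, ?_⟩
  ext x
  have := Equiv.congr_fun h (L.symm x)
  simpa using congrArg Fin.val this

/-- Summation over `des_n(≤ {i, j})` by means of the decomposition into shuffles. -/
lemma sum_desLE {E : Type*} [AddCommMonoid E] (hij : i < j) (hj : j < n)
    (f : Equiv.Perm (Fin n) → Equiv.Perm (Fin n) → E) :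
    ∑ σ : desLE n {i, j}, f (decomposition hij hj σ).1 (decomposition hij hj σ).2 =
      ∑ L ∈ shuffles n 0 j (n - j), ∑ R ∈ shuffles n 0 i (j - i), f L R := by
  have spec : ∀ σ : desLE n {i, j}, IsShuffle 0 j (n - j) (decomposition hij hj σ).1 ∧
      IsShuffle 0 i (j - i) (decomposition hij hj σ).2 ∧
      (decomposition hij hj σ).1.trans (decomposition hij hj σ).2 = σ.1 := fun σ =>
    (exists_decomposition hij hj σ).choose_spec
  rw [← Finset.sum_product']
  refine Finset.sum_bij (fun σ _ => decomposition hij hj σ) ?_ ?_ ?_ ?_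
  · intro σ _
    rw [Finset.mem_product, mem_shuffles, mem_shuffles]
    exact ⟨(spec σ).1, (spec σ).2.1⟩
  · intro σ _ τ _ e
    apply Subtype.ext
    rw [← (spec σ).2.2, ← (spec τ).2.2, e]
  · rintro ⟨L, R⟩ h
    rw [Finset.mem_product, mem_shuffles, mem_shuffles] at h
    refine ⟨⟨L.trans R, trans_mem_desLE hij hj h.1 h.2⟩, Finset.mem_univ _, ?_⟩
    obtain ⟨h1, h2, h3⟩ := spec ⟨L.trans R, trans_mem_desLE hij hj h.1 h.2⟩
    obtain ⟨e1, e2⟩ := trans_shuffle_injective hij h1 h2 h.1 h.2 h3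
    exact Prod.ext e1 e2
  · intro σ _; rfl

end Decomposition

/-! ### Local operators on the tensor algebra -/

section TensorAlgebraOps

open TensorPower (toTensorAlgebra)

variable {K W : Type*} [Field K] [AddCommGroup W] [Module K W]

lemma equivDirectSum_toTensorAlgebra {n : ℕ} (z : ⨂[K]^n W) :
    TensorAlgebra.equivDirectSum (toTensorAlgebra z) = DirectSum.of (fun n => ⨂[K]^n W) n z := by
  have : (TensorAlgebra.equivDirectSum (R := K) (M := W)).toLinearMap ∘ₗ toTensorAlgebra =
      DirectSum.lof K ℕ (fun n => ⨂[K]^n W) n := by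
    refine PiTensorProduct.ext (MultilinearMap.ext fun v => ?_)
    simp only [LinearMap.compMultilinearMap_apply, LinearMap.comp_apply,
      TensorPower.toTensorAlgebra_tprod, AlgEquiv.toLinearMap_apply,
      TensorAlgebra.equivDirectSum_apply, TensorAlgebra.toDirectSum_tensorPower_tprod]
    rfl
  exact LinearMap.congr_fun this z

lemma tensorAlgebra_linearMap_ext {X : Type*} [AddCommGroup X] [Module K X]
    {f g : TensorAlgebra K W →ₗ[K] X}
    (h : ∀ (n : ℕ) (v : Fin n → W), f (TensorAlgebra.tprod K W n v) =
      g (TensorAlgebra.tprod K W n v)) : f = g := by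
  have : f ∘ₗ TensorAlgebra.equivDirectSum.symm.toLinearMap =
      g ∘ₗ TensorAlgebra.equivDirectSum.symm.toLinearMap := by
    refine DirectSum.linearMap_ext K fun n => PiTensorProduct.ext (MultilinearMap.ext fun v => ?_)
    have e : TensorAlgebra.equivDirectSum.symm
        (DirectSum.lof K ℕ (fun n => ⨂[K]^n W) n (PiTensorProduct.tprod K v)) =
        TensorAlgebra.tprod K W n v := by
      rw [AlgEquiv.symm_apply_eq, ← TensorPower.toTensorAlgebra_tprod,
        equivDirectSum_toTensorAlgebra]
      rfl
    simp only [LinearMap.compMultilinearMap_apply, LinearMap.comp_apply,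
      AlgEquiv.toLinearMap_apply, e, h]
  ext t
  simpa using LinearMap.congr_fun this (TensorAlgebra.equivDirectSum t)

lemma tprod_cons {n : ℕ} (x : W) (v : Fin n → W) :
    TensorAlgebra.tprod K W (n + 1) (Fin.cons x v) =
      TensorAlgebra.ι K x * TensorAlgebra.tprod K W n v := by
  simp [TensorAlgebra.tprod_apply, List.ofFn_succ]

lemma tprod_eq_ι_mul {n : ℕ} (v : Fin (n + 1) → W) :
    TensorAlgebra.tprod K W (n + 1) v =
      TensorAlgebra.ι K (v 0) * TensorAlgebra.tprod K W n (Fin.tail v) := by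
  rw [← tprod_cons, Fin.cons_self_tail]

/-- The operator that applies `f` to the letters `i`, `i + 1` of each word of length greater
than `i`. -/
def tensorOp (f : W ⊗[K] W →ₗ[K] W ⊗[K] W) (i : ℕ) : Module.End K (TensorAlgebra K W) :=
  (DirectSum.toModule K ℕ (TensorAlgebra K W) fun n => toTensorAlgebra ∘ₗ localOp n f i) ∘ₗ
    TensorAlgebra.equivDirectSum.toLinearMap

/-- Moves computations from a fixed tensor power into `T(W)`, where prefixes and suffixes split off
by multiplication instead of by reindexing. -/
lemma tensorOp_toTensorAlgebra (f : W ⊗[K] W →ₗ[K] W ⊗[K] W) (i : ℕ) {n : ℕ} (z : ⨂[K]^n W) :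
    tensorOp f i (toTensorAlgebra z) = toTensorAlgebra (localOp n f i z) := by
  rw [tensorOp, LinearMap.comp_apply, AlgEquiv.toLinearMap_apply, equivDirectSum_toTensorAlgebra,
    ← DirectSum.lof_eq_of K, DirectSum.toModule_lof, LinearMap.comp_apply]

/-- The linear map `a ⊗ b ↦ a b` from `W ⊗ W` to `T(W)`. -/
def tensorMul : W ⊗[K] W →ₗ[K] TensorAlgebra K W :=
  LinearMap.mul' K _ ∘ₗ TensorProduct.map (TensorAlgebra.ι K) (TensorAlgebra.ι K)

@[simp] lemma tensorMul_tmul (a b : W) :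
    tensorMul (K := K) (a ⊗ₜ b) = TensorAlgebra.ι K a * TensorAlgebra.ι K b := rfl

/-- The hypothesis `1 ≤ i` matters: at index `0` the operator is the identity by convention, whereas
at index `1` it acts on the letter `x`. -/
lemma tensorOp_ι_mul (f : W ⊗[K] W →ₗ[K] W ⊗[K] W) {i : ℕ} (hi : 1 ≤ i) (x : W)
    (t : TensorAlgebra K W) : tensorOp f (i + 1) (TensorAlgebra.ι K x * t) =
      TensorAlgebra.ι K x * tensorOp f i t := by
  have : tensorOp f (i + 1) ∘ₗ LinearMap.mulLeft K (TensorAlgebra.ι K x) =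
      LinearMap.mulLeft K (TensorAlgebra.ι K x) ∘ₗ tensorOp f i := by
    refine tensorAlgebra_linearMap_ext fun n v => ?_
    simp only [LinearMap.comp_apply, LinearMap.mulLeft_apply]
    rw [← tprod_cons, ← TensorPower.toTensorAlgebra_tprod, ← TensorPower.toTensorAlgebra_tprod,
      tensorOp_toTensorAlgebra, tensorOp_toTensorAlgebra]
    rcases Nat.lt_or_ge i n with h | h
    · obtain ⟨i, rfl⟩ := Nat.exists_eq_succ_of_ne_zero (Nat.one_le_iff_ne_zero.1 hi)
      rw [localOp, dif_pos (by omega), localOp, dif_pos (by omega), twoSite_tprod, twoSite_tprod]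
      have e1 : (Fin.cons x v : Fin (n + 1) → W) ⟨i.succ + 1 - 1, by omega⟩ =
          v ⟨i.succ - 1, by omega⟩ :=
        Fin.cons_succ (α := fun _ => W) x v ⟨i, by omega⟩
      have e2 : (Fin.cons x v : Fin (n + 1) → W) ⟨i.succ + 1, by omega⟩ = v ⟨i.succ, h⟩ :=
        Fin.cons_succ (α := fun _ => W) x v ⟨i.succ, h⟩
      rw [e1, e2]
      induction f (v ⟨i.succ - 1, by omega⟩ ⊗ₜ[K] v ⟨i.succ, h⟩)
        using TensorProduct.induction_on with
      | zero => simp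
      | add y z hy hz => simp only [map_add, hy, hz, mul_add]
      | tmul a b =>
        rw [insertTwo_tmul, insertTwo_tmul, TensorPower.toTensorAlgebra_tprod,
          TensorPower.toTensorAlgebra_tprod, ← tprod_cons]
        congr 1
        rw [Fin.cons_update, Fin.cons_update]
        rfl
    -- The word is too short, and both operators have their default value `1`.
    · rw [localOp, dif_neg (by omega), localOp, dif_neg (by omega)]
      simp [tprod_cons, -TensorAlgebra.tprod_apply]
  exact LinearMap.congr_fun this t

lemma tensorOp_one_ι_mul (f : W ⊗[K] W →ₗ[K] W ⊗[K] W) (x y : W) (t : TensorAlgebra K W) :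
    tensorOp f 1 (TensorAlgebra.ι K x * (TensorAlgebra.ι K y * t)) =
      tensorMul (f (x ⊗ₜ y)) * t := by
  have : tensorOp f 1 ∘ₗ LinearMap.mulLeft K (TensorAlgebra.ι K x) ∘ₗ
      LinearMap.mulLeft K (TensorAlgebra.ι K y) = LinearMap.mulLeft K (tensorMul (f (x ⊗ₜ y))) := by
    refine tensorAlgebra_linearMap_ext fun n v => ?_
    simp only [LinearMap.comp_apply, LinearMap.mulLeft_apply]
    rw [← tprod_cons, ← tprod_cons, ← TensorPower.toTensorAlgebra_tprod,
      tensorOp_toTensorAlgebra, localOp, dif_pos (by omega), twoSite_tprod]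
    change toTensorAlgebra (insertTwo _ _ (f (x ⊗ₜ y))) = _
    induction f (x ⊗ₜ y) using TensorProduct.induction_on with
    | zero => simp
    | add a b ha hb => simp only [map_add, ha, hb, add_mul]
    | tmul a b =>
      rw [insertTwo_tmul, TensorPower.toTensorAlgebra_tprod, tensorMul_tmul, mul_assoc,
        ← tprod_cons, ← tprod_cons]
      congr 1
      have e1 : Function.update (Fin.cons x (Fin.cons y v : Fin (n + 1) → W) : Fin (n + 2) → W)
          ⟨1 - 1, by omega⟩ a = Fin.cons a (Fin.cons y v : Fin (n + 1) → W) :=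
        Fin.update_cons_zero (α := fun _ => W) x _ a
      rw [e1]
      have e2 := Fin.cons_update (α := fun _ : Fin (n + 2) => W) a
        (Fin.cons y v : Fin (n + 1) → W) 0 b
      have e3 := Fin.update_cons_zero (α := fun _ : Fin (n + 1) => W) y v b
      rw [e3] at e2
      exact e2.symm
  exact LinearMap.congr_fun this t

/-- The homogeneous component of degree `n` of `T(W)`. -/
abbrev tensorDeg (K W : Type*) [Field K] [AddCommGroup W] [Module K W] (n : ℕ) :
    Submodule K (TensorAlgebra K W) := LinearMap.range (TensorAlgebra.ι K (M := W)) ^ n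

lemma ι_mem_tensorDeg (x : W) : TensorAlgebra.ι K x ∈ tensorDeg K W 1 := by
  simp [tensorDeg]

lemma mul_mem_tensorDeg {m n : ℕ} {s t : TensorAlgebra K W} (hs : s ∈ tensorDeg K W m)
    (ht : t ∈ tensorDeg K W n) : s * t ∈ tensorDeg K W (m + n) := by
  rw [tensorDeg, pow_add]; exact Submodule.mul_mem_mul hs ht

lemma ι_mul_mem_tensorDeg {n : ℕ} (x : W) {t : TensorAlgebra K W} (ht : t ∈ tensorDeg K W n) :
    TensorAlgebra.ι K x * t ∈ tensorDeg K W (n + 1) := by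
  rw [add_comm]; exact mul_mem_tensorDeg (ι_mem_tensorDeg x) ht

lemma toTensorAlgebra_mem_tensorDeg {n : ℕ} (z : ⨂[K]^n W) :
    toTensorAlgebra z ∈ tensorDeg K W n := by
  induction z using PiTensorProduct.induction_on with
  | smul_tprod r v =>
    rw [map_smul, TensorPower.toTensorAlgebra_tprod]
    refine Submodule.smul_mem _ _ ?_
    induction n with
    | zero => simp [TensorAlgebra.tprod_apply, Submodule.one_le.1]
    | succ n ih =>
      rw [tprod_eq_ι_mul]
      exact ι_mul_mem_tensorDeg _ (ih _)
  | add x y hx hy => rw [map_add]; exact Submodule.add_mem _ hx hy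

/-- The component of degree `n + 1` is spanned by the products `x t` with `x` of degree one and `t`
of degree `n`. -/
lemma tensorDeg_succ_induction {n : ℕ}
    {P : ∀ t : TensorAlgebra K W, t ∈ tensorDeg K W (n + 1) → Prop}
    (hmul : ∀ (x : W) (t : TensorAlgebra K W) (ht : t ∈ tensorDeg K W n),
      P (TensorAlgebra.ι K x * t) (ι_mul_mem_tensorDeg x ht))
    (hadd : ∀ s hs t ht, P s hs → P t ht → P (s + t) (Submodule.add_mem _ hs ht))
    {t : TensorAlgebra K W} (ht : t ∈ tensorDeg K W (n + 1)) : P t ht := by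
  have key : ∀ t, t ∈ LinearMap.range (TensorAlgebra.ι K (M := W)) * tensorDeg K W n →
      ∃ ht, P t ht := by
    intro t ht
    refine Submodule.mul_induction_on ht ?_ ?_
    · rintro _ ⟨x, rfl⟩ t ht
      exact ⟨_, hmul x t ht⟩
    · rintro s t ⟨_, hs⟩ ⟨_, ht⟩
      exact ⟨_, hadd _ _ _ _ hs ht⟩
  exact (key t (by rwa [tensorDeg, pow_succ'] at ht)).2

lemma tensorMul_mem_tensorDeg (z : W ⊗[K] W) : tensorMul z ∈ tensorDeg K W 2 := by
  induction z using TensorProduct.induction_on with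
  | zero => simp
  | add x y hx hy => rw [map_add]; exact Submodule.add_mem _ hx hy
  | tmul a b => exact mul_mem_tensorDeg (ι_mem_tensorDeg a) (ι_mem_tensorDeg b)

lemma exists_algebraMap_of_mem_tensorDeg_zero {t : TensorAlgebra K W}
    (ht : t ∈ tensorDeg K W 0) : ∃ r : K, algebraMap K _ r = t := by
  rwa [tensorDeg, pow_zero, Submodule.mem_one] at ht

/-- Local operators do not see a prefix that ends before them. -/
lemma tensorOp_mul (f : W ⊗[K] W →ₗ[K] W ⊗[K] W) {c : ℕ} {u : TensorAlgebra K W}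
    (hu : u ∈ tensorDeg K W c) {i : ℕ} (hi : 1 ≤ i) (t : TensorAlgebra K W) :
    tensorOp f (c + i) (u * t) = u * tensorOp f i t := by
  induction c generalizing u with
  | zero =>
    obtain ⟨r, rfl⟩ := exists_algebraMap_of_mem_tensorDeg_zero hu
    simp [← Algebra.smul_def]
  | succ c ih =>
    induction hu using tensorDeg_succ_induction with
    | hmul x s hs =>
      rw [mul_assoc, show c + 1 + i = c + i + 1 by omega, tensorOp_ι_mul f (by omega), ih hs,
        mul_assoc]
    | hadd s _ s' _ h h' => simp only [add_mul, map_add, h, h']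

/-- Local operators do not see a suffix that begins after them. -/
lemma tensorOp_mul_right (f : W ⊗[K] W →ₗ[K] W ⊗[K] W) {m : ℕ} {u : TensorAlgebra K W}
    (hu : u ∈ tensorDeg K W m) {i : ℕ} (hi : 1 ≤ i) (him : i < m) (t : TensorAlgebra K W) :
    tensorOp f i (u * t) = tensorOp f i u * t := by
  induction i, hi using Nat.le_induction generalizing m u with
  | base =>
    obtain ⟨m, rfl⟩ := Nat.exists_eq_add_of_le' him
    induction hu using tensorDeg_succ_induction with
    | hadd s _ s' _ h h' => simp only [add_mul, map_add, h, h']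
    | hmul x s hs =>
      induction hs using tensorDeg_succ_induction with
      | hadd s _ s' _ h h' => simp only [mul_add, add_mul, map_add, h, h']
      | hmul y s hs =>
        rw [mul_assoc, mul_assoc, tensorOp_one_ι_mul, tensorOp_one_ι_mul, mul_assoc]
  | succ i hi ih =>
    obtain ⟨m, rfl⟩ := Nat.exists_eq_add_of_le' (show 1 ≤ m by omega)
    induction hu using tensorDeg_succ_induction with
    | hadd s _ s' _ h h' => simp only [add_mul, map_add, h, h']
    | hmul x s hs =>
      rw [mul_assoc, tensorOp_ι_mul f hi, tensorOp_ι_mul f hi, ih hs (by omega), mul_assoc]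

lemma tensorOp_mem_tensorDeg (f : W ⊗[K] W →ₗ[K] W ⊗[K] W) {m i : ℕ} (hi : 1 ≤ i) (him : i < m)
    {u : TensorAlgebra K W} (hu : u ∈ tensorDeg K W m) : tensorOp f i u ∈ tensorDeg K W m := by
  induction i, hi using Nat.le_induction generalizing m u with
  | base =>
    obtain ⟨m, rfl⟩ := Nat.exists_eq_add_of_le' him
    induction hu using tensorDeg_succ_induction with
    | hadd s _ s' _ h h' => rw [map_add]; exact Submodule.add_mem _ h h'
    | hmul x s hs =>
      induction hs using tensorDeg_succ_induction with
      | hadd s _ s' _ h h' => rw [mul_add, map_add]; exact Submodule.add_mem _ h h'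
      | hmul y s hs =>
        rw [tensorOp_one_ι_mul, show m + 1 + 1 = 2 + m by omega]
        exact mul_mem_tensorDeg (tensorMul_mem_tensorDeg _) hs
  | succ i hi ih =>
    obtain ⟨m, rfl⟩ := Nat.exists_eq_add_of_le' (show 1 ≤ m by omega)
    induction hu using tensorDeg_succ_induction with
    | hadd s _ s' _ h h' => rw [map_add]; exact Submodule.add_mem _ h h'
    | hmul x s hs =>
      rw [tensorOp_ι_mul f hi]
      exact ι_mul_mem_tensorDeg x (ih (by omega) hs)

end TensorAlgebraOps

/-! ### Transport of operators along intertwining maps -/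

section Intertwining

variable {K X Y : Type*} [Field K] [AddCommGroup X] [Module K X] [AddCommGroup Y] [Module K Y]

/-- The shift `c` is meant for `φ` that puts a prefix of degree `c` in front of a word; the
invariant subspace `S` allows intertwining relations that hold only in one degree. -/
lemma opProd_intertwine {s : ℕ → Module.End K X} {s' : ℕ → Module.End K Y} (φ : X →ₗ[K] Y)
    (S : Submodule K X) (c a b : ℕ)
    (h : ∀ i, a ≤ i → i ≤ b → ∀ z ∈ S, s i z ∈ S ∧ s' (c + i) (φ z) = φ (s i z))
    {z : X} (hz : z ∈ S) :
    opProd s a b z ∈ S ∧ opProd s' (c + a) (c + b) (φ z) = φ (opProd s a b z) := by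
  induction hN : b + 1 - a generalizing a with
  | zero =>
    rw [opProd_eq_one s (by omega), opProd_eq_one s' (by omega)]
    exact ⟨hz, rfl⟩
  | succ N ih =>
    obtain ⟨h1, h2⟩ := ih (a + 1) (fun i hi => h i (by omega)) (by omega)
    obtain ⟨h3, h4⟩ := h a le_rfl (by omega) _ h1
    rw [opProd_eq_mul s (by omega), opProd_eq_mul s' (by omega)]
    exact ⟨h3, by rw [Module.End.mul_apply, Module.End.mul_apply, add_assoc, h2, h4]⟩

/-- Only generators of index between `1` and `c + p + q - 1` occur, so relations below `m` are
enough. They are needed in this bounded form when `φ` appends a suffix to words of length `m`. -/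
lemma shuffleOp_intertwine {s x : ℕ → Module.End K X} {s' x' : ℕ → Module.End K Y} (φ : X →ₗ[K] Y)
    (S : Submodule K X) {m : ℕ}
    (hs : ∀ i, 1 ≤ i → i < m → ∀ z ∈ S, s i z ∈ S ∧ s' i (φ z) = φ (s i z))
    (hx : ∀ i, 1 ≤ i → i < m → ∀ z ∈ S, x i z ∈ S ∧ x' i (φ z) = φ (x i z))
    (c p q : ℕ) (hm : c + p + q ≤ m) {z : X} (hz : z ∈ S) :
    shuffleOp s x c p q z ∈ S ∧ shuffleOp s' x' c p q (φ z) = φ (shuffleOp s x c p q z) := by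
  have hprod : ∀ a b, 1 ≤ a → b < m → ∀ z ∈ S, opProd s a b z ∈ S ∧
      opProd s' a b (φ z) = φ (opProd s a b z) := by
    intro a b ha hb z hz
    have := opProd_intertwine (s' := s') φ S 0 a b
      (fun i hi hi' z hz => by rw [zero_add]; exact hs i (by omega) (by omega) z hz) hz
    rwa [zero_add, zero_add] at this
  induction c, p, q using shuffle_induction generalizing z with
  | left c q => simpa using hz
  | right c p => simpa using hz
  | step c p q h1 h2 h3 =>
    obtain ⟨a1, a2⟩ := h1 (by omega) hz
    obtain ⟨b1, b2⟩ := hprod (c + 1) (c + p + 1) (by omega) (by omega) z hz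
    obtain ⟨c1, c2⟩ := h2 (by omega) b1
    obtain ⟨d1, d2⟩ := hprod (c + 2) (c + p + 1) (by omega) (by omega) z hz
    obtain ⟨e1, e2⟩ := hx (c + 1) (by omega) (by omega) _ d1
    obtain ⟨f1, f2⟩ := hprod 1 c (by omega) (by omega) _ e1
    obtain ⟨g1, g2⟩ := h3 (by omega) f1
    simp only [shuffleOp_succ, LinearMap.add_apply, Module.End.mul_apply, map_add]
    refine ⟨Submodule.add_mem _ (Submodule.add_mem _ a1 c1) g1, ?_⟩
    rw [a2, b2, c2, d2, e2, f2, g2]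

end Intertwining

lemma quasiShuffleAux_zero {K V : Type*} [Field K] [AddCommGroup V] [Module K V]
    (B : BraidedAlgebra K V) (n : ℕ) :
    quasiShuffleAux B n 0 = TensorPower.toTensorAlgebra := by
  rcases n with _ | _ | n <;> rw [quasiShuffleAux]

lemma quasiShuffleAux_self {K V : Type*} [Field K] [AddCommGroup V] [Module K V]
    (B : BraidedAlgebra K V) (n : ℕ) :
    quasiShuffleAux B n n = TensorPower.toTensorAlgebra := by
  rcases n with _ | _ | n <;> rw [quasiShuffleAux]
  rw [if_neg (lt_irrefl _)]

/-! ### Deleting units turns `shuffleOp` into the quasi-shuffle product -/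

namespace AugmentedBraidedAlgebra

open TensorPower (toTensorAlgebra)

variable {K W : Type*} [Field K] [AddCommGroup W] [Module K W] (A : AugmentedBraidedAlgebra K W)

/-- The inclusion `T(V) → T(V̂)`. -/
def incl : TensorAlgebra K A.V →ₐ[K] TensorAlgebra K W :=
  TensorAlgebra.lift K (TensorAlgebra.ι K ∘ₗ A.V.subtype)

@[simp] lemma incl_ι (v : A.V) : A.incl (TensorAlgebra.ι K v) = TensorAlgebra.ι K (v : W) := by
  simp [incl]

lemma incl_tprod {n : ℕ} (v : Fin n → A.V) :
    A.incl (TensorAlgebra.tprod K A.V n v) = TensorAlgebra.tprod K W n fun k => (v k : W) := by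
  simp [TensorAlgebra.tprod_apply, map_list_prod, Function.comp_def]

@[simp] lemma deleting_incl (t : TensorAlgebra K A.V) : A.deleting (A.incl t) = t := by
  have : A.deleting.comp A.incl = AlgHom.id K _ := by
    ext v
    simp [A.deleting_mem]
  exact AlgHom.congr_fun this t

lemma incl_tensorMul (z : A.V ⊗[K] A.V) :
    A.incl (tensorMul z) = tensorMul (TensorProduct.mapIncl A.V A.V z) := by
  induction z using TensorProduct.induction_on with
  | zero => simp
  | add x y hx hy => simp only [map_add, hx, hy]
  | tmul a b => simp

lemma incl_mem_tensorDeg {n : ℕ} {t : TensorAlgebra K A.V} (ht : t ∈ tensorDeg K A.V n) :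
    A.incl t ∈ tensorDeg K W n := by
  induction n generalizing t with
  | zero =>
    obtain ⟨r, rfl⟩ := exists_algebraMap_of_mem_tensorDeg_zero ht
    simp [tensorDeg, Submodule.mem_one]
  | succ n ih =>
    induction ht using tensorDeg_succ_induction with
    | hadd s _ s' _ h h' => rw [map_add]; exact Submodule.add_mem _ h h'
    | hmul x s hs => rw [map_mul, incl_ι]; exact ι_mul_mem_tensorDeg _ (ih hs)

lemma tensorOp_incl {m i : ℕ} (hi : 1 ≤ i) (him : i < m) {u : TensorAlgebra K A.V}
    (hu : u ∈ tensorDeg K A.V m) :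
    tensorOp A.σ i (A.incl u) = A.incl (tensorOp A.restrict.σ i u) := by
  induction i, hi using Nat.le_induction generalizing m u with
  | base =>
    obtain ⟨m, rfl⟩ := Nat.exists_eq_add_of_le' him
    induction hu using tensorDeg_succ_induction with
    | hadd s _ s' _ h h' => simp only [map_add, h, h']
    | hmul x s hs =>
      induction hs using tensorDeg_succ_induction with
      | hadd s _ s' _ h h' => simp only [mul_add, map_add, h, h']
      | hmul y s hs =>
        rw [tensorOp_one_ι_mul, map_mul A.incl, map_mul A.incl, map_mul A.incl, incl_ι, incl_ι,
          tensorOp_one_ι_mul, incl_tensorMul, A.restrict_σ]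
        rfl
  | succ i hi ih =>
    obtain ⟨m, rfl⟩ := Nat.exists_eq_add_of_le' (show 1 ≤ m by omega)
    induction hu using tensorDeg_succ_induction with
    | hadd s _ s' _ h h' => simp only [map_add, h, h']
    | hmul x s hs =>
      rw [map_mul A.incl, incl_ι, tensorOp_ι_mul _ hi, tensorOp_ι_mul _ hi, map_mul, incl_ι,
        ih (by omega) hs]

/-- The braiding moves a unit to the front of a word. -/
lemma opProd_σ_one {c : ℕ} {u : TensorAlgebra K W} (hu : u ∈ tensorDeg K W c)
    (t : TensorAlgebra K W) :
    opProd (tensorOp A.σ) 1 c (u * (TensorAlgebra.ι K A.one * t)) =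
      TensorAlgebra.ι K A.one * (u * t) := by
  induction c generalizing u with
  | zero =>
    obtain ⟨r, rfl⟩ := exists_algebraMap_of_mem_tensorDeg_zero hu
    rw [opProd_eq_one _ (by omega)]
    simp [← Algebra.smul_def]
  | succ c ih =>
    induction hu using tensorDeg_succ_induction with
    | hadd s _ s' _ h h' => simp only [add_mul, mul_add, map_add, h, h']
    | hmul x s hs =>
      -- The factors `σ_2 ⋯ σ_{c+1}` act behind the first letter `x` and bring the unit next to it;
      -- `σ_1` then exchanges the two.
      have h := (opProd_intertwine (s := tensorOp A.σ) (s' := tensorOp A.σ)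
        (LinearMap.mulLeft K (TensorAlgebra.ι K x)) ⊤ 1 1 c (fun i hi _ z _ =>
          ⟨trivial, by rw [add_comm]; exact tensorOp_ι_mul _ hi x z⟩)
        (z := s * (TensorAlgebra.ι K A.one * t)) trivial).2
      simp only [LinearMap.mulLeft_apply] at h
      rw [opProd_eq_mul _ (by omega), Module.End.mul_apply, mul_assoc, add_comm c 1, h, ih hs,
        tensorOp_one_ι_mul, A.braid_one_right, tensorMul_tmul, mul_assoc, mul_assoc]

/-- `σ_{c+a} ⋯ σ_{c+b}` acts on `u ⊗ z` as `id ⊗ (σ_a ⋯ σ_b)` if `u` has degree `c`. -/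
lemma opProd_σ_mul_incl {c n a b : ℕ} (ha : 1 ≤ a) (hb : b < n) {u : TensorAlgebra K W}
    (hu : u ∈ tensorDeg K W c) (z : ⨂[K]^n A.V) :
    opProd (tensorOp A.σ) (c + a) (c + b) (u * A.incl (toTensorAlgebra z)) =
      u * A.incl (toTensorAlgebra (braidProd n A.restrict.σ a b z)) := by
  have h := (opProd_intertwine (s := localOp n A.restrict.σ) (s' := tensorOp A.σ)
    (LinearMap.mulLeft K u ∘ₗ A.incl.toLinearMap ∘ₗ toTensorAlgebra) ⊤ c a b
    (fun i hi hi' z _ => ⟨trivial, by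
      simp only [LinearMap.comp_apply, LinearMap.mulLeft_apply, AlgHom.toLinearMap_apply]
      rw [tensorOp_mul _ hu (by omega), A.tensorOp_incl (by omega) (by omega)
        (toTensorAlgebra_mem_tensorDeg z), tensorOp_toTensorAlgebra]⟩) (z := z) trivial).2
  exact h

/-- The first letter of `z` joins the prefix, whose degree becomes `c + 1`. Deletion is
multiplicative and keeps letters of `V`, so the letter reappears as the factor that `consMap` puts
in front of `g`. -/
lemma deleting_consMap {c m : ℕ} (Op : Module.End K (TensorAlgebra K W))
    (g : ⨂[K]^m A.V →ₗ[K] TensorAlgebra K A.V)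
    (h : ∀ u ∈ tensorDeg K W (c + 1), ∀ z : ⨂[K]^m A.V,
      A.deleting (Op (u * A.incl (toTensorAlgebra z))) = A.deleting u * g z)
    {u : TensorAlgebra K W} (hu : u ∈ tensorDeg K W c) (z : ⨂[K]^(m + 1) A.V) :
    A.deleting (Op (u * A.incl (toTensorAlgebra z))) = A.deleting u * consMap g z := by
  have : A.deleting.toLinearMap ∘ₗ Op ∘ₗ LinearMap.mulLeft K u ∘ₗ A.incl.toLinearMap ∘ₗ
      toTensorAlgebra = LinearMap.mulLeft K (A.deleting u) ∘ₗ consMap g := by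
    refine PiTensorProduct.ext (MultilinearMap.ext fun v => ?_)
    simp only [LinearMap.compMultilinearMap_apply, LinearMap.comp_apply, LinearMap.mulLeft_apply,
      AlgHom.toLinearMap_apply, consMap_tprod, TensorPower.toTensorAlgebra_tprod]
    rw [tprod_eq_ι_mul, map_mul A.incl, incl_ι, ← mul_assoc, ← TensorPower.toTensorAlgebra_tprod,
      h _ (mul_mem_tensorDeg hu (ι_mem_tensorDeg _)), map_mul, A.deleting_mem, mul_assoc]
  exact LinearMap.congr_fun this z

/-- Behind `u`, the contraction turns `v₀ ⊗ v₁` into `𝟏 ⊗ m(v₀ ⊗ v₁)`, and `σ_1 ⋯ σ_c` moves the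
unit in front of `u`. The new prefix `𝟏 u m(v₀ ⊗ v₁)` has degree `c + 2`, which is why the recursion
continues at `c + 2`, and deletion reduces it to `D(u) m(v₀ ⊗ v₁)`. -/
lemma deleting_mulConsMap {c m : ℕ} (Op : Module.End K (TensorAlgebra K W))
    (g : ⨂[K]^m A.V →ₗ[K] TensorAlgebra K A.V)
    (h : ∀ u ∈ tensorDeg K W (c + 2), ∀ z : ⨂[K]^m A.V,
      A.deleting (Op (u * A.incl (toTensorAlgebra z))) = A.deleting u * g z)
    {u : TensorAlgebra K W} (hu : u ∈ tensorDeg K W c) (z : ⨂[K]^(m + 2) A.V) :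
    A.deleting (Op (opProd (tensorOp A.σ) 1 c (tensorOp A.σm (c + 1)
      (u * A.incl (toTensorAlgebra z))))) = A.deleting u * mulConsMap A.restrict.m g z := by
  have : A.deleting.toLinearMap ∘ₗ Op ∘ₗ opProd (tensorOp A.σ) 1 c ∘ₗ tensorOp A.σm (c + 1) ∘ₗ
      LinearMap.mulLeft K u ∘ₗ A.incl.toLinearMap ∘ₗ toTensorAlgebra =
      LinearMap.mulLeft K (A.deleting u) ∘ₗ mulConsMap A.restrict.m g := by
    refine PiTensorProduct.ext (MultilinearMap.ext fun v => ?_)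
    simp only [LinearMap.compMultilinearMap_apply, LinearMap.comp_apply, LinearMap.mulLeft_apply,
      AlgHom.toLinearMap_apply, mulConsMap_tprod, TensorPower.toTensorAlgebra_tprod]
    have hm := A.restrict_m (v 0 ⊗ₜ v 1)
    have hu' : TensorAlgebra.ι K A.one * u * TensorAlgebra.ι K
        (A.restrict.m (v 0 ⊗ₜ v 1) : W) ∈ tensorDeg K W (c + 2) :=
      mul_mem_tensorDeg (m := c + 1) (ι_mul_mem_tensorDeg _ hu) (ι_mem_tensorDeg _)
    have h' := h _ hu' (PiTensorProduct.tprod K (Fin.tail (Fin.tail v)))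
    rw [tprod_eq_ι_mul, tprod_eq_ι_mul, map_mul A.incl, map_mul A.incl, incl_ι, incl_ι,
      tensorOp_mul _ hu le_rfl,
      tensorOp_one_ι_mul, σm_tmul, tensorMul_tmul, mul_assoc, A.opProd_σ_one hu]
    rw [TensorPower.toTensorAlgebra_tprod, map_mul A.deleting, map_mul A.deleting, A.deleting_one,
      A.deleting_mem, hm,
      _root_.one_mul, mul_assoc, mul_assoc, mul_assoc] at h'
    exact h'
  exact LinearMap.congr_fun this z

/-- After deletion of the units, `shuffleOp` is the quantum quasi-shuffle product. -/
theorem deleting_shuffleOp (c p q : ℕ) {n : ℕ} (hn : p + q = n) {u : TensorAlgebra K W}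
    (hu : u ∈ tensorDeg K W c) (z : ⨂[K]^n A.V) :
    A.deleting (shuffleOp (tensorOp A.σ) (tensorOp A.σm) c p q
      (u * A.incl (toTensorAlgebra z))) = A.deleting u * quasiShuffleAux A.restrict n p z := by
  induction c, p, q using shuffle_induction generalizing n u with
  | left c q => simp [quasiShuffleAux_zero]
  | right c p =>
    obtain rfl : p = n := by omega
    simp [quasiShuffleAux_self]
  | step c p q h1 h2 h3 =>
    obtain ⟨m, rfl⟩ : ∃ m, n = m + 2 := ⟨p + q, by omega⟩
    rw [quasiShuffleAux, if_pos (by omega), shuffleOp_succ]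
    simp only [LinearMap.add_apply, LinearMap.comp_apply, Module.End.mul_apply, map_add, mul_add]
    -- Behind the prefix, `a = 1` gives the braiding `β_{p+1,1}` and `a = 2` gives `id ⊗ β_{p,1}`,
    -- as in the recursion for `∗_{p+1,q+1}`.
    have e : ∀ a, 1 ≤ a → opProd (tensorOp A.σ) (c + a) (c + p + 1)
        (u * A.incl (toTensorAlgebra z)) =
        u * A.incl (toTensorAlgebra (braidProd (m + 2) A.restrict.σ a (p + 1) z)) :=
      fun a ha => A.opProd_σ_mul_incl (b := p + 1) ha (by omega) hu z
    rw [e 1 le_rfl, e 2 (by omega)]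
    congr 1
    congr 1
    · exact A.deleting_consMap _ _ (fun u hu z => h1 (by omega) hu z) hu z
    · exact A.deleting_consMap _ _ (fun u hu z => h2 (by omega) hu z) hu _
    · exact A.deleting_mulConsMap _ _ (fun u hu z => h3 (by omega) hu z) hu _

@[simp] lemma action_gσ (n i : ℕ) : A.action n (gσ K n i) = localOp n A.σ i := by
  rw [gσ]
  split_ifs with h
  · rw [action, MonoidAlgebra.lift_of, monoidAction, PresentedMonoid.lift_of, genAction]
  · rw [map_one, localOp, dif_neg h]

@[simp] lemma action_gξ (n i : ℕ) : A.action n (gξ K n i) = localOp n A.σm i := by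
  rw [gξ]
  split_ifs with h
  · rw [action, MonoidAlgebra.lift_of, monoidAction, PresentedMonoid.lift_of, genAction]
  · rw [map_one, localOp, dif_neg h]

/-- No bound on `c + p + q` is needed: a generator whose index is out of range acts as the identity
on both sides. -/
lemma toTensorAlgebra_action_shuffleOp {n : ℕ} (c p q : ℕ) (z : ⨂[K]^n W) :
    toTensorAlgebra (A.action n (shuffleOp (gσ K n) (gξ K n) c p q) z) =
      shuffleOp (tensorOp A.σ) (tensorOp A.σm) c p q (toTensorAlgebra z) := by
  rw [map_shuffleOp]
  simp only [action_gσ, action_gξ]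
  exact ((shuffleOp_intertwine (toTensorAlgebra : ⨂[K]^n W →ₗ[K] TensorAlgebra K W) ⊤
    (fun i _ _ z _ => ⟨trivial, tensorOp_toTensorAlgebra _ i z⟩)
    (fun i _ _ z _ => ⟨trivial, tensorOp_toTensorAlgebra _ i z⟩) c p q le_rfl trivial).2).symm

end AugmentedBraidedAlgebra

open TensorPower (toTensorAlgebra)

/-! ### Cutting tensors at a given degree -/

section TensorAlgebraOps

variable {K W : Type*} [Field K] [AddCommGroup W] [Module K W]

lemma exists_toTensorAlgebra_eq {n : ℕ} {t : TensorAlgebra K W} (ht : t ∈ tensorDeg K W n) :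
    ∃ z : ⨂[K]^n W, toTensorAlgebra z = t := by
  induction n generalizing t with
  | zero =>
    obtain ⟨r, rfl⟩ := exists_algebraMap_of_mem_tensorDeg_zero ht
    exact ⟨_, TensorPower.toTensorAlgebra_galgebra_toFun r⟩
  | succ n ih =>
    induction ht using tensorDeg_succ_induction with
    | hadd s _ s' _ h h' =>
      obtain ⟨z, rfl⟩ := h
      obtain ⟨z', rfl⟩ := h'
      exact ⟨z + z', map_add _ _ _⟩
    | hmul x s hs =>
      obtain ⟨z, rfl⟩ := ih hs
      induction z using PiTensorProduct.induction_on with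
      | smul_tprod r v =>
        refine ⟨r • PiTensorProduct.tprod K (Fin.cons x v), ?_⟩
        rw [map_smul, map_smul, TensorPower.toTensorAlgebra_tprod,
          TensorPower.toTensorAlgebra_tprod, tprod_cons, mul_smul_comm]
      | add a b ha hb =>
        obtain ⟨a', ha⟩ := ha (toTensorAlgebra_mem_tensorDeg a)
        obtain ⟨b', hb⟩ := hb (toTensorAlgebra_mem_tensorDeg b)
        exact ⟨a' + b', by rw [map_add, map_add, mul_add, ha, hb]⟩

lemma tprod_append {m n : ℕ} (v : Fin m → W) (w : Fin n → W) :
    TensorAlgebra.tprod K W (m + n) (Fin.append v w) =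
      TensorAlgebra.tprod K W m v * TensorAlgebra.tprod K W n w := by
  rw [← TensorPower.toTensorAlgebra_tprod, ← TensorPower.tprod_mul_tprod,
    TensorPower.toTensorAlgebra_gMul, TensorPower.toTensorAlgebra_tprod,
    TensorPower.toTensorAlgebra_tprod]

/-- The linear map on `T(W)` that sends `s t` to `β(s, t)` for `s` of degree `m` and `t` of
degree `n`, and vanishes in degrees other than `m + n`. -/
def splitMap {X : Type*} [AddCommGroup X] [Module K X] (m n : ℕ)
    (β : TensorAlgebra K W →ₗ[K] TensorAlgebra K W →ₗ[K] X) : TensorAlgebra K W →ₗ[K] X :=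
  TensorProduct.lift (β.compl₁₂ (toTensorAlgebra (n := m)) (toTensorAlgebra (n := n))) ∘ₗ
    TensorPower.mulEquiv.symm.toLinearMap ∘ₗ
    DirectSum.component K ℕ (fun n => ⨂[K]^n W) (m + n) ∘ₗ
    TensorAlgebra.equivDirectSum.toLinearMap

lemma splitMap_mul {X : Type*} [AddCommGroup X] [Module K X] {m n : ℕ}
    (β : TensorAlgebra K W →ₗ[K] TensorAlgebra K W →ₗ[K] X) {s t : TensorAlgebra K W}
    (hs : s ∈ tensorDeg K W m) (ht : t ∈ tensorDeg K W n) : splitMap m n β (s * t) = β s t := by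
  obtain ⟨a, rfl⟩ := exists_toTensorAlgebra_eq hs
  obtain ⟨b, rfl⟩ := exists_toTensorAlgebra_eq ht
  rw [← TensorPower.toTensorAlgebra_gMul, TensorPower.gMul_def, splitMap]
  simp only [LinearMap.comp_apply, AlgEquiv.toLinearMap_apply, equivDirectSum_toTensorAlgebra]
  rw [← DirectSum.lof_eq_of K, DirectSum.component.lof_self]
  simp

end TensorAlgebraOps

/-! ### Virtual length and the linear extension of `M` -/

section Monoid

variable {n : ℕ}

/-- `σ_i ∈ GVB_n^+` for `1 ≤ i ≤ n - 1`, and `1` for other `i`. -/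
def bσ (n i : ℕ) : GVB n :=
  if h : 1 ≤ i ∧ i < n then PresentedMonoid.of (Rel n) (.sigma i h) else 1

/-- `ξ_i ∈ GVB_n^+` for `1 ≤ i ≤ n - 1`, and `1` for other `i`. -/
def bξ (n i : ℕ) : GVB n :=
  if h : 1 ≤ i ∧ i < n then PresentedMonoid.of (Rel n) (.xi i h) else 1

lemma virtualLength_one : virtualLength (1 : GVB n) = 0 := by simp [virtualLength]

lemma virtualLength_mul (τ τ' : GVB n) :
    virtualLength (τ * τ') = virtualLength τ + virtualLength τ' := by simp [virtualLength]

lemma virtualLength_bσ (i : ℕ) : virtualLength (bσ n i) = 0 := by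
  rw [bσ]
  split_ifs with h
  · simp [virtualLength, virtualLengthHom]
  · exact virtualLength_one

lemma virtualLength_bξ {i : ℕ} (h : 1 ≤ i ∧ i < n) : virtualLength (bξ n i) = 1 := by
  rw [bξ, dif_pos h]
  simp [virtualLength, virtualLengthHom]

lemma virtualLength_opProd (a b : ℕ) : virtualLength (opProd (bσ n) a b) = 0 := by
  rw [opProd]
  induction interval a b with
  | nil => exact virtualLength_one
  | cons i l ih => rw [List.map_cons, List.prod_cons, virtualLength_mul, virtualLength_bσ, ih]

variable (K : Type*) [Field K]

lemma gσ_eq_of (i : ℕ) : gσ K n i = MonoidAlgebra.of K _ (bσ n i) := by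
  rw [gσ, bσ]; split_ifs
  · rfl
  · rw [map_one]

lemma gξ_eq_of (i : ℕ) : gξ K n i = MonoidAlgebra.of K _ (bξ n i) := by
  rw [gξ, bξ]; split_ifs
  · rfl
  · rw [map_one]

lemma opProd_gσ (a b : ℕ) :
    opProd (gσ K n) a b = MonoidAlgebra.of K _ (opProd (bσ n) a b) := by
  rw [map_opProd]
  congr 1
  funext i
  exact gσ_eq_of K i

lemma M_add (p q : ℕ) (σ : Equiv.Perm (Fin n)) (x y : MonoidAlgebra K (GVB n)) :
    M K p q σ (x + y) = M K p q σ x + M K p q σ y := by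
  rw [M, MonoidAlgebra.coeff_add, Finsupp.sum_add_index' (by simp) (by simp [add_smul])]
  rfl

lemma M_smul (p q : ℕ) (σ : Equiv.Perm (Fin n)) (a : K) (x : MonoidAlgebra K (GVB n)) :
    M K p q σ (a • x) = a • M K p q σ x := by
  rw [M, MonoidAlgebra.coeff_smul, Finsupp.sum_smul_index' (by simp), M, Finsupp.smul_sum]
  simp [mul_smul]

lemma M_of (p q : ℕ) (σ : Equiv.Perm (Fin n)) (τ : GVB n) :
    M K p q σ (MonoidAlgebra.of K _ τ) = MBasis K p q σ τ := by
  simp [M]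

lemma M_one {p q : ℕ} (hp : 0 < p) {σ : Equiv.Perm (Fin n)} (h : IsShuffle 0 p q σ) :
    M K p q σ 1 = lift K σ := by
  rw [← map_one (MonoidAlgebra.of K (GVB n)), M_of, MBasis, virtualLength_one,
    if_pos ⟨hp, h⟩, map_one, mul_one]

/-- `M_{p,q}(σ, ·)` as a linear map. -/
def MHom (p q : ℕ) (σ : Equiv.Perm (Fin n)) :
    MonoidAlgebra K (GVB n) →ₗ[K] MonoidAlgebra K (GVB n) where
  toFun := M K p q σ
  map_add' := M_add K p q σ
  map_smul' := M_smul K p q σ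

/-- For fixed `τ` of virtual length `l`, the nonzero terms are those of `𝔖_{p-l,q}^{↑l}`, a subset
of `𝔖_{p,q}` by `IsShuffle.of_add`. So the sum of lifts starts its recursion at `c = l`, just behind
the units that `τ` is meant to have produced. -/
lemma sum_MBasis {p q : ℕ} (hn : p + q ≤ n) {τ : GVB n} (hτ : virtualLength τ < p) :
    ∑ σ ∈ shuffles n 0 p q, MBasis K p q σ τ =
      shuffleOp (gσ K n) (gξ K n) (virtualLength τ) (p - virtualLength τ) q *
        MonoidAlgebra.of K _ τ := by
  classical
  rw [← sum_lift_shuffles K _ _ _ (by omega), Finset.sum_mul]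
  simp only [MBasis, hτ, true_and]
  rw [← Finset.sum_filter]
  refine Finset.sum_congr ?_ fun _ _ => rfl
  ext σ
  simp only [Finset.mem_filter, mem_shuffles, and_iff_right_iff_imp]
  intro h
  have h' := IsShuffle.of_add (k := 0) (l := virtualLength τ) (by rwa [zero_add])
  rwa [Nat.sub_add_cancel hτ.le] at h'

end Monoid

/-! ### Leading units and the iterated product -/

namespace AugmentedBraidedAlgebra

variable {K W : Type*} [Field K] [AddCommGroup W] [Module K W] (A : AugmentedBraidedAlgebra K W)

/-- The space `𝟏^{⊗ l} ⊗ V^{⊗ (n - l)}` in `T(V̂)`. -/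
def unitTensors (n l : ℕ) : Submodule K (TensorAlgebra K W) :=
  (tensorDeg K A.V (n - l)).map
    (LinearMap.mulLeft K (TensorAlgebra.ι K A.one ^ l) ∘ₗ A.incl.toLinearMap)

lemma mem_unitTensors {n l : ℕ} {w : TensorAlgebra K W} : w ∈ A.unitTensors n l ↔
    ∃ t ∈ tensorDeg K A.V (n - l), TensorAlgebra.ι K A.one ^ l * A.incl t = w := Iff.rfl

lemma one_pow_mem_tensorDeg (l : ℕ) : TensorAlgebra.ι K A.one ^ l ∈ tensorDeg K W l :=
  Submodule.pow_mem_pow _ (LinearMap.mem_range_self _ _) l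

lemma tensorOp_σ_mem_unitTensors {n l i : ℕ} (hl : l < i) (hi : i < n) {w : TensorAlgebra K W}
    (hw : w ∈ A.unitTensors n l) : tensorOp A.σ i w ∈ A.unitTensors n l := by
  obtain ⟨t, ht, rfl⟩ := A.mem_unitTensors.1 hw
  obtain ⟨r, rfl⟩ := Nat.exists_eq_add_of_lt hl
  rw [add_assoc, tensorOp_mul _ (A.one_pow_mem_tensorDeg l) (by omega),
    A.tensorOp_incl (by omega) (by omega) ht]
  exact A.mem_unitTensors.2 ⟨_, tensorOp_mem_tensorDeg _ (by omega) (by omega) ht, rfl⟩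

lemma opProd_σ_mem_unitTensors {n l a b : ℕ} (hl : l < a) (hb : b < n) {w : TensorAlgebra K W}
    (hw : w ∈ A.unitTensors n l) : opProd (tensorOp A.σ) a b w ∈ A.unitTensors n l :=
  (opProd_intertwine (s := tensorOp A.σ) (s' := tensorOp A.σ) LinearMap.id _ 0 a b
    (fun i hi hi' _ hz => ⟨A.tensorOp_σ_mem_unitTensors (by omega) (by omega) hz,
      by rw [zero_add]; rfl⟩) hw).1

/-- Write the tensor as `𝟏^l t₁ x y s` with `t₁` of degree `c - l`. Contracting `x` and `y` creates
a unit, which the braiding moves to the front, giving `𝟏^{l+1} t₁ m(x ⊗ y) s`; the product stays in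
`V` because `m` restricts. -/
lemma opProd_σ_σm_mem_unitTensors {n l c : ℕ} (hl : l ≤ c) (hc : c + 1 < n)
    {w : TensorAlgebra K W} (hw : w ∈ A.unitTensors n l) :
    opProd (tensorOp A.σ) 1 c (tensorOp A.σm (c + 1) w) ∈ A.unitTensors n (l + 1) := by
  obtain ⟨t, ht, rfl⟩ := A.mem_unitTensors.1 hw
  clear hw
  obtain ⟨b, rfl⟩ := Nat.exists_eq_add_of_le hl
  obtain ⟨r, rfl⟩ := Nat.exists_eq_add_of_lt hc
  rw [show l + b + 1 + r + 1 - l = b + (r + 1 + 1) by omega, tensorDeg, pow_add] at ht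
  refine Submodule.mul_induction_on ht (fun t₁ h₁ t₂ h₂ => ?_) (fun s s' h h' => ?_)
  · change t₂ ∈ tensorDeg K A.V (r + 1 + 1) at h₂
    have hu : TensorAlgebra.ι K A.one ^ l * A.incl t₁ ∈ tensorDeg K W (l + b) :=
      mul_mem_tensorDeg (A.one_pow_mem_tensorDeg l) (A.incl_mem_tensorDeg h₁)
    induction h₂ using tensorDeg_succ_induction with
    | hadd s _ s' _ h h' => simp only [mul_add, map_add]; exact Submodule.add_mem _ h h'
    | hmul x s hs =>
      induction hs using tensorDeg_succ_induction with
      | hadd s _ s' _ h h' => simp only [mul_add, map_add]; exact Submodule.add_mem _ h h'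
      | hmul y s hs =>
        refine A.mem_unitTensors.2
          ⟨t₁ * (TensorAlgebra.ι K (A.restrict.m (x ⊗ₜ y)) * s), ?_, ?_⟩
        · rw [show l + b + 1 + r + 1 - (l + 1) = b + (r + 1) by omega]
          exact mul_mem_tensorDeg h₁ (ι_mul_mem_tensorDeg _ hs)
        · simp only [map_mul A.incl, incl_ι]
          rw [← mul_assoc (TensorAlgebra.ι K A.one ^ l) (A.incl t₁), tensorOp_mul _ hu le_rfl,
            tensorOp_one_ι_mul, σm_tmul,
            tensorMul_tmul, mul_assoc (TensorAlgebra.ι K A.one), A.opProd_σ_one hu, A.restrict_m,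
            pow_succ']
          simp only [mul_assoc]
          rfl
  · simp only [mul_add, map_add]; exact Submodule.add_mem _ h h'

lemma monoidAction_bσ (n i : ℕ) : A.monoidAction n (bσ n i) = localOp n A.σ i := by
  have := A.action_gσ n i
  rwa [gσ_eq_of, action, MonoidAlgebra.lift_of] at this

lemma monoidAction_bξ (n i : ℕ) : A.monoidAction n (bξ n i) = localOp n A.σm i := by
  have := A.action_gξ n i
  rwa [gξ_eq_of, action, MonoidAlgebra.lift_of] at this

lemma toTensorAlgebra_opProd_bσ {n : ℕ} (a b : ℕ) (z : ⨂[K]^n W) :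
    toTensorAlgebra (A.monoidAction n (opProd (bσ n) a b) z) =
      opProd (tensorOp A.σ) a b (toTensorAlgebra z) := by
  rw [map_opProd]
  simp only [monoidAction_bσ]
  have := (opProd_intertwine (s := localOp n A.σ) (s' := tensorOp A.σ)
    (toTensorAlgebra : ⨂[K]^n W →ₗ[K] TensorAlgebra K W) ⊤ 0 a b
    (fun i _ _ z _ => ⟨trivial, by rw [zero_add, tensorOp_toTensorAlgebra]⟩) (z := z) trivial).2
  rw [zero_add, zero_add] at this
  exact this.symm

/-- The monomials that take `z` to a tensor beginning with as many units as their virtual length,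
which is at most `N`. -/
def reducedMonomials {n : ℕ} (z : ⨂[K]^n W) (N : ℕ) : Set (GVB n) :=
  {τ | virtualLength τ ≤ N ∧
    toTensorAlgebra (A.monoidAction n τ z) ∈ A.unitTensors n (virtualLength τ)}

/-- Along the recursion, every `ξ` raises the virtual length by one and adds one leading unit. The
condition `l_v(τ) ≤ c` keeps the other braidings away from the units already there. Each contraction
consumes a letter of the first word, so at most `p` of them occur, which gives the bound `N`. -/
lemma shuffleOp_mul_of_mem {n N : ℕ} (z : ⨂[K]^n W) (c p q : ℕ) (hn : c + p + q ≤ n) {τ : GVB n}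
    (hc : virtualLength τ ≤ c) (hN : virtualLength τ + p ≤ N)
    (hτ : toTensorAlgebra (A.monoidAction n τ z) ∈ A.unitTensors n (virtualLength τ)) :
    shuffleOp (gσ K n) (gξ K n) c p q * MonoidAlgebra.of K _ τ ∈
      Submodule.span K (MonoidAlgebra.of K (GVB n) '' A.reducedMonomials z N) := by
  induction c, p, q using shuffle_induction generalizing τ with
  | left c q =>
    rw [shuffleOp_zero_left, _root_.one_mul]
    exact Submodule.subset_span ⟨τ, ⟨by omega, hτ⟩, rfl⟩
  | right c p =>
    rw [shuffleOp_zero_right, _root_.one_mul]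
    exact Submodule.subset_span ⟨τ, ⟨by omega, hτ⟩, rfl⟩
  | step c p q h1 h2 h3 =>
    rw [shuffleOp_succ, add_mul, add_mul]
    refine Submodule.add_mem _ (Submodule.add_mem _ ?_ ?_) ?_
    · exact h1 (by omega) (by omega) (by omega) hτ
    · rw [mul_assoc, opProd_gσ, ← map_mul]
      have e : virtualLength (opProd (bσ n) (c + 1) (c + p + 1) * τ) = virtualLength τ := by
        rw [virtualLength_mul, virtualLength_opProd, zero_add]
      refine h2 (by omega) (by omega) (by omega) ?_
      rw [e, map_mul, Module.End.mul_apply, toTensorAlgebra_opProd_bσ]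
      exact A.opProd_σ_mem_unitTensors (by omega) (by omega) hτ
    · rw [mul_assoc, opProd_gσ, opProd_gσ, gξ_eq_of, ← map_mul, ← map_mul, ← map_mul]
      have e : virtualLength (opProd (bσ n) 1 c * bξ n (c + 1) *
          opProd (bσ n) (c + 2) (c + p + 1) * τ) = virtualLength τ + 1 := by
        rw [virtualLength_mul, virtualLength_mul, virtualLength_mul, virtualLength_opProd,
          virtualLength_opProd, virtualLength_bξ (by omega)]
        omega
      refine h3 (by omega) (by omega) (by omega) ?_
      rw [e]
      simp only [map_mul, Module.End.mul_apply]
      rw [toTensorAlgebra_opProd_bσ, monoidAction_bξ, ← tensorOp_toTensorAlgebra,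
        toTensorAlgebra_opProd_bσ]
      exact A.opProd_σ_σm_mem_unitTensors (by omega) (by omega)
        (A.opProd_σ_mem_unitTensors (by omega) (by omega) hτ)

/-- The linear map on `T(V̂)` with `s t ↦ D(s) ∗ D(t)` for `s` of degree `m` and `t` of degree
`n`. -/
def shuffleDeleting (m n : ℕ) : TensorAlgebra K W →ₗ[K] TensorAlgebra K A.V :=
  splitMap m n ((quasiShuffle A.restrict).compl₁₂ A.deleting.toLinearMap A.deleting.toLinearMap)

lemma shuffleDeleting_mul {m n : ℕ} {s t : TensorAlgebra K W} (hs : s ∈ tensorDeg K W m)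
    (ht : t ∈ tensorDeg K W n) : A.shuffleDeleting m n (s * t) =
      quasiShuffle A.restrict (A.deleting s) (A.deleting t) :=
  splitMap_mul _ hs ht

lemma tprod_mem_tensorDeg {n : ℕ} (v : Fin n → W) :
    TensorAlgebra.tprod K W n v ∈ tensorDeg K W n := by
  rw [← TensorPower.toTensorAlgebra_tprod]; exact toTensorAlgebra_mem_tensorDeg _

/-- The cut after `l + p` letters leaves all `l` units in the left piece, where they are deleted.
For `l + p = j` the map on the left is the same for every `l`; this is what makes it linear across
different virtual lengths. -/
lemma shuffleDeleting_one_pow_mul (l p q : ℕ) (y : ⨂[K]^(p + q) A.V) :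
    A.shuffleDeleting (l + p) q (TensorAlgebra.ι K A.one ^ l * A.incl (toTensorAlgebra y)) =
      quasiShuffleAux A.restrict (p + q) p y := by
  have : A.shuffleDeleting (l + p) q ∘ₗ LinearMap.mulLeft K (TensorAlgebra.ι K A.one ^ l) ∘ₗ
      A.incl.toLinearMap ∘ₗ toTensorAlgebra = quasiShuffleAux A.restrict (p + q) p := by
    refine PiTensorProduct.ext (MultilinearMap.ext fun v => ?_)
    obtain ⟨a, b, rfl⟩ : ∃ (a : Fin p → A.V) (b : Fin q → A.V), v = Fin.append a b :=
      ⟨_, _, Fin.append_castAdd_natAdd.symm⟩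
    simp only [LinearMap.compMultilinearMap_apply, LinearMap.comp_apply, LinearMap.mulLeft_apply,
      AlgHom.toLinearMap_apply, TensorPower.toTensorAlgebra_tprod]
    rw [tprod_append, map_mul A.incl, ← mul_assoc, shuffleDeleting_mul, map_mul A.deleting,
      map_pow, A.deleting_one, one_pow, _root_.one_mul, deleting_incl, deleting_incl,
      quasiShuffle_tprod]
    · refine mul_mem_tensorDeg (A.one_pow_mem_tensorDeg l) ?_
      rw [incl_tprod]; exact tprod_mem_tensorDeg _
    · rw [incl_tprod]; exact tprod_mem_tensorDeg _
  exact LinearMap.congr_fun this y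

/-- Both sides are linear in `x`, so a monomial `τ` of virtual length `l ≤ i < j` suffices; there `l
< j` meets the first condition in `MBasis`. It takes `z` to `𝟏^l y`. By `sum_MBasis` and
`deleting_shuffleOp` the left side is the product of the first `j - l` letters of `y` with the
others, and by `shuffleDeleting_one_pow_mul` so is the right side. -/
lemma sum_M_eq_shuffleDeleting {n i j : ℕ} (hij : i < j) (hj : j ≤ n) (z : ⨂[K]^n W)
    {x : MonoidAlgebra K (GVB n)}
    (hx : x ∈ Submodule.span K (MonoidAlgebra.of K (GVB n) '' A.reducedMonomials z i)) :
    A.deleting (toTensorAlgebra (A.action n (∑ σ ∈ shuffles n 0 j (n - j), M K j (n - j) σ x) z)) =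
      A.shuffleDeleting j (n - j) (toTensorAlgebra (A.action n x z)) := by
  have hM : ∀ x, ∑ σ ∈ shuffles n 0 j (n - j), M K j (n - j) σ x =
      (∑ σ ∈ shuffles n 0 j (n - j), MHom K j (n - j) σ) x := fun x => by
    rw [LinearMap.sum_apply]; rfl
  induction hx using Submodule.span_induction with
  | zero => rw [hM]; simp
  | add x y _ _ hx hy =>
    rw [hM] at hx hy ⊢
    simp only [map_add, LinearMap.add_apply, hx, hy]
  | smul a x _ hx =>
    rw [hM] at hx ⊢
    simp only [map_smul, LinearMap.smul_apply, hx]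
  | mem x hx =>
    obtain ⟨τ, ⟨hτ, hτz⟩, rfl⟩ := hx
    obtain ⟨t, ht, e⟩ := A.mem_unitTensors.1 hτz
    obtain ⟨p, rfl⟩ := Nat.exists_eq_add_of_le (show virtualLength τ ≤ j by omega)
    obtain ⟨q, hq⟩ := Nat.exists_eq_add_of_le hj
    rw [show n - virtualLength τ = p + q by omega] at ht
    obtain ⟨y, rfl⟩ := exists_toTensorAlgebra_eq ht
    have haction : A.action _ (MonoidAlgebra.of K _ τ) z = A.monoidAction _ τ z := by
      rw [action, MonoidAlgebra.lift_of]
    simp only [M_of]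
    rw [show n - (virtualLength τ + p) = q by omega, sum_MBasis K (by omega) (by omega),
      map_mul, Module.End.mul_apply,
      toTensorAlgebra_action_shuffleOp, haction, ← e, Nat.add_sub_cancel_left,
      A.deleting_shuffleOp _ _ _ rfl (A.one_pow_mem_tensorDeg _),
      shuffleDeleting_one_pow_mul, map_pow, A.deleting_one, one_pow, _root_.one_mul]

/-- The iterated quasi-shuffle product of three words. -/
lemma quasiShuffle_quasiShuffle_tprod {p q r : ℕ} (a : Fin p → A.V) (b : Fin q → A.V)
    (c : Fin r → A.V) :
    quasiShuffle A.restrict (quasiShuffle A.restrict (TensorAlgebra.tprod K A.V p a)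
        (TensorAlgebra.tprod K A.V q b)) (TensorAlgebra.tprod K A.V r c) =
      A.shuffleDeleting (p + q) r (shuffleOp (tensorOp A.σ) (tensorOp A.σm) 0 p q
        (A.incl (TensorAlgebra.tprod K A.V _ (Fin.append (Fin.append a b) c)))) := by
  have hab := A.incl_mem_tensorDeg
    (toTensorAlgebra_mem_tensorDeg (K := K) (PiTensorProduct.tprod K (Fin.append a b)))
  rw [TensorPower.toTensorAlgebra_tprod] at hab
  -- Shuffling the first `p + q` letters does not see the third word, so it commutes with right
  -- multiplication by that word.
  have h := shuffleOp_intertwine (s := tensorOp A.σ) (s' := tensorOp A.σ) (x := tensorOp A.σm)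
    (x' := tensorOp A.σm) (LinearMap.mulRight K (A.incl (TensorAlgebra.tprod K A.V r c)))
    (tensorDeg K W (p + q)) (m := p + q)
    (fun i hi hi' z hz => ⟨tensorOp_mem_tensorDeg _ hi hi' hz, tensorOp_mul_right _ hz hi hi' _⟩)
    (fun i hi hi' z hz => ⟨tensorOp_mem_tensorDeg _ hi hi' hz, tensorOp_mul_right _ hz hi hi' _⟩)
    0 p q (by omega) hab
  -- With empty prefix this is the inner product of the first two words.
  have hA := A.deleting_shuffleOp 0 p q rfl (u := 1) (by simp [tensorDeg, Submodule.one_le.1])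
    (PiTensorProduct.tprod K (Fin.append a b))
  rw [_root_.one_mul, map_one, _root_.one_mul, TensorPower.toTensorAlgebra_tprod,
    ← quasiShuffle_tprod] at hA
  rw [tprod_append, map_mul A.incl]
  have h2 := h.2
  simp only [LinearMap.mulRight_apply] at h2
  rw [h2, A.shuffleDeleting_mul h.1, hA, deleting_incl]
  rw [incl_tprod]; exact tprod_mem_tensorDeg _

end AugmentedBraidedAlgebra

/-- Replaces the length `b - a`, which occurs in a type, by a variable. -/
lemma segment_eq_tprod {K V : Type*} [Field K] [AddCommGroup V] [Module K V] {n : ℕ}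
    (v : Fin n → V) (a b : ℕ) (hb : b ≤ n) (m : ℕ) (hm : a + m = b) :
    segment (K := K) v a b hb = TensorAlgebra.tprod K V m fun k => v ⟨a + k, by omega⟩ := by
  obtain rfl : m = b - a := by omega
  rfl

end QuasiShuffle

end

/-! ### The triple product -/

open QuasiShuffle in
theorem theorem3p2 {K W : Type*} [Field K] [AddCommGroup W] [Module K W]
    (A : AugmentedBraidedAlgebra K W) {n i j : ℕ} (hi : 1 ≤ i) (hij : i < j) (hj : j < n)
    (v : Fin n → A.V) :
    quasiShuffle A.restrict
        (quasiShuffle A.restrict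
          (segment (K := K) v 0 i (by omega)) (segment v i j (by omega)))
        (segment v j n le_rfl) =
      A.deleting (TensorPower.toTensorAlgebra
        (∑ σ : desLE n {i, j},
          A.action n (QLE K hij hj σ) (PiTensorProduct.tprod K fun k => (v k : W)))) := by
  set z : ⨂[K]^n W := PiTensorProduct.tprod K fun k => (v k : W) with hz
  have hzT : TensorPower.toTensorAlgebra z = A.incl (TensorAlgebra.tprod K A.V n v) := by
    rw [hz, TensorPower.toTensorAlgebra_tprod, A.incl_tprod]
  -- The inner sum of lifts is a combination of monomials that behave well on `z`: start from `τ =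
  -- 1`, with no units, and use that the first word has `i` letters.
  have hX : shuffleOp (gσ K n) (gξ K n) 0 i (j - i) ∈ Submodule.span K
      (MonoidAlgebra.of K (GVB n) '' A.reducedMonomials z i) := by
    have := A.shuffleOp_mul_of_mem (N := i) z 0 i (j - i) (by omega) (τ := 1)
      (by rw [virtualLength_one]) (by rw [virtualLength_one, zero_add]) (by
        rw [virtualLength_one, map_one, Module.End.one_apply, hzT]
        refine A.mem_unitTensors.2 ⟨_, ?_, by rw [pow_zero, one_mul]⟩
        rw [← TensorPower.toTensorAlgebra_tprod]
        exact toTensorAlgebra_mem_tensorDeg _)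
    rwa [map_one, mul_one] at this
  have hsum : ∑ σ : desLE n {i, j}, A.action n (QLE K hij hj σ) z =
      A.action n (∑ σ ∈ shuffles n 0 j (n - j),
        M K j (n - j) σ (shuffleOp (gσ K n) (gξ K n) 0 i (j - i))) z := by
    -- Since `M` is linear in its last argument, the sum over the right factors can be carried out
    -- inside it, where it becomes `shuffleOp`.
    rw [← LinearMap.sum_apply, ← map_sum]
    congr 2
    simp only [QLE]
    rw [sum_desLE hij hj fun L R => M K j (n - j) L (M K i (j - i) R 1)]
    refine Finset.sum_congr rfl fun L _ => ?_
    rw [← sum_lift_shuffles K 0 i (j - i) (by omega)]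
    change _ = MHom K j (n - j) L _
    rw [map_sum]
    refine Finset.sum_congr rfl fun R hR => ?_
    rw [M_one K hi (mem_shuffles.1 hR)]
    rfl
  rw [hsum, A.sum_M_eq_shuffleDeleting hij hj.le z hX, A.toTensorAlgebra_action_shuffleOp, hzT]
  obtain ⟨d, rfl⟩ := Nat.exists_eq_add_of_le hij.le
  obtain ⟨r, rfl⟩ := Nat.exists_eq_add_of_le hj.le
  rw [Nat.add_sub_cancel_left, Nat.add_sub_cancel_left, segment_eq_tprod v 0 i _ i (by omega),
    segment_eq_tprod v i (i + d) _ d rfl, segment_eq_tprod v (i + d) (i + d + r) _ r rfl,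
    A.quasiShuffle_quasiShuffle_tprod]
  congr 4
  funext k
  -- Concatenating the three segments recovers `v`; check each block of positions.
  refine Fin.addCases (fun k => ?_) (fun k => ?_) k
  · refine Fin.addCases (fun k => ?_) (fun k => ?_) k
    · rw [Fin.append_left, Fin.append_left]
      congr 1; ext; simp
    · rw [Fin.append_left, Fin.append_right]
      rfl
  · rw [Fin.append_right]
    rfl
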